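/- Let $n,\lambda\ge 1$ be integers, $0<c\le 1$, $d_\sigma>0$, and let $f:\mathbb{R}^n\to\mathbb{R}$ be $f(x)=g(\langle a,x\rangle+b)$ with $a\in\mathbb{R}^n\setminus\{0\}$, $b\in\mathbb{R}$ and $g:\mathbb{R}\to\mathbb{R}$ strictly increasing. Let $\xi_{t,i}$ ($t\in\mathbb{N}$, $1\le i\le\lambda$) be i.i.d. random vectors with law $\mathcal{N}(0,I_n)$. The $(1,\lambda)$-CSA-ES minimizing $f$ starts from a parent $X_0$, a step-size $\sigma_0>0$ and a path $p_0\sim\mathcal{N}(0,I_n)$. At iteration $t$ let $\xi_t^\star$ be a vector among $\xi_{t,1},\dots,\xi_{t,\lambda}$ for which $f(X_t+\sigma_t\xi_t^\star)\le f(X_t+\sigma_t\xi_{t,i})$ for all $i$ (ties being broken arbitrarily), and put $$X_{t+1}=X_t+\sigma_t\,\xi_t^\star,\qquad p_{t+1}=(1-c)\,p_t+\sqrt{c(2-c)}\;\xi_t^\star,\qquad \sigma_{t+1}=\sigma_t\exp\left(\frac{c}{2d_\sigma}\left(\frac{\|p_{t+1}\|^2}{n}-1\right)\right).$$ Let $\mathcal{N}_{1:\lambda}$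 denote the minimum of $\lambda$ independent standard normal random variables. Then, almost surely and in expectation, $$\frac1t\ln\left(\frac{\sigma_t}{\sigma_0}\right)\xrightarrow[t\to\infty]{}\frac{1}{2d_\sigma n}\Big(2(1-c)\,\mathbb{E}(\mathcal{N}_{1:\lambda})^2+c\big(\mathbb{E}(\mathcal{N}_{1:\lambda}^2)-1\big)\Big),$$ where "in expectation" means that $\ln(\sigma_t/\sigma_0)$ is integrable for every $t$ and that $\mathbb{E}\big(\frac1t\ln(\sigma_t/\sigma_0)\big)$ converges to the right-hand side. If $\lambda\ge3$, or if $\lambda=2$ and $c<1$, the limit is strictly positive, so that the step-size diverges geometrically; in particular $\sigma_t\to\infty$ almost surely. -/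

import Mathlib

open MeasureTheory ProbabilityTheory Filter
open scoped Topology

/-- The law of `N_{1:lam}`, the minimum of `lam` independent standard normal variables. -/
noncomputable def minNormalLaw (lam : ℕ) : Measure ℝ :=
  (Measure.pi fun _ : Fin lam => gaussianReal 0 1).map fun x => ⨅ i, x i

/-- The expectation of `(N_{1:lam}) ^ k`. -/
noncomputable def minNormalMoment (lam k : ℕ) : ℝ :=
  ∫ x, x ^ k ∂(minNormalLaw lam)

/-- The quantity
`1 / (2 d n) * (2 (1 - c) (E N_{1:lam})² + c (E (N_{1:lam}²) - 1))`. -/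
noncomputable def csaRate (n lam : ℕ) (c d : ℝ) : ℝ :=
  1 / (2 * d * n) *
    (2 * (1 - c) * minNormalMoment lam 1 ^ 2 + c * (minNormalMoment lam 2 - 1))

/-- `IsCSARun f c d z X σ p` : the sequences of parents `X t`, step-sizes `σ t` and cumulative
paths `p t` form a run of the (1,lam)-CSA-ES minimizing `f`, with cumulation parameter `c` and
damping `d`, in which the mutation vectors sampled at iteration `t` are `z t i`, `i : Fin lam`.
The initial values are any `X 0`, `p 0` and any `σ 0 > 0`; a child of lowest `f`-value is selected,
ties being broken in any way. -/
structure IsCSARun {n lam : ℕ} (f : EuclideanSpace ℝ (Fin n) → ℝ) (c d : ℝ)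
    (z : ℕ → Fin lam → EuclideanSpace ℝ (Fin n))
    (X : ℕ → EuclideanSpace ℝ (Fin n)) (σ : ℕ → ℝ) (p : ℕ → EuclideanSpace ℝ (Fin n)) :
    Prop where
  stepSize_zero_pos : 0 < σ 0
  /-- The selected step `z t i` is the one of a best child; it moves the parent and the path. -/
  select : ∀ t, ∃ i : Fin lam,
    (∀ j : Fin lam, f (X t + σ t • z t i) ≤ f (X t + σ t • z t j)) ∧
      X (t + 1) = X t + σ t • z t i ∧
      p (t + 1) = (1 - c) • p t + √(c * (2 - c)) • z t i
  stepSize_succ : ∀ t,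
    σ (t + 1) = σ t * Real.exp (c / (2 * d) * (‖p (t + 1)‖ ^ 2 / n - 1))

/-! Taking logarithms, the step-size recursion telescopes: `log (σ t / σ 0)` is an affine function
of the sum of the `‖p (s + 1)‖ ^ 2`, so everything reduces to the time averages of the squared path
norms.

Since `f` increases with `⟨a, x⟩`, the best child is the one whose mutation has the smallest
component along `u = a / ‖a‖`, whatever the parent and the step-size. Ties are negligible, so the
selected steps are almost surely an i.i.d. sequence `ξ` (`exists_iid_bestStep`). The components
orthogonal to `u` are independent of the selection, hence `ξ` has mean `E N_{1:lam} • u` and second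
moment `E N_{1:lam}² + (n - 1)`.

The path is an exponential smoothing `p (s + 1) = α • p s + κ • ξ s` with `α = 1 - c` and `κ ^ 2 = 1
- α ^ 2`. The deterministic theorem `tendsto_average_norm_sq_smoothed`, valid in any real inner
product space, gives the limiting average of `‖p‖ ^ 2` from that of `‖x s‖ ^ 2` (limit `V`) and from
the autocorrelations at positive lags (limit `W`). It is used twice: pathwise, where the strong law
supplies the averages, and in `L²(μ)`, where inner products are expectations and the averages are
constant. This yields the almost sure limit and the limit in expectation.

Positivity comes from comparing the tails of `|N_{1:lam}|` with those of `|N|`: equal for `lam = 2`,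
strictly larger for `lam ≥ 3`. -/

set_option linter.unusedSectionVars false

/-! ### Deterministic averages of an exponentially smoothed sequence -/

section Averages

/-- A family with `|e j (t + 1)| ≤ α |e (j + 1) t| + o(1)`, `α < 1`, and a uniform bound on the
limsups tends to zero. -/
lemma tendsto_zero_of_abs_succ_le {e δ : ℕ → ℕ → ℝ} {α M : ℝ} (hα0 : 0 ≤ α) (hα1 : α < 1)
    (hrec : ∀ j t, |e j (t + 1)| ≤ α * |e (j + 1) t| + δ j t)
    (hδ : ∀ j, Tendsto (δ j) atTop (𝓝 0)) (hM : ∀ j, ∀ᶠ t in atTop, |e j t| ≤ M) (j : ℕ) :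
    Tendsto (e j) atTop (𝓝 0) := by
  -- Each use of the recursion gains a factor `α` but raises the index `j`, so the induction must
  -- carry all `j` at once; this is why `M` is uniform in `j`.
  have key : ∀ k j : ℕ, ∀ ε > 0, ∀ᶠ t in atTop, |e j t| ≤ α ^ k * M + ε := by
    intro k
    induction k with
    | zero =>
      intro j ε hε
      filter_upwards [hM j] with t ht
      simp only [pow_zero, one_mul]
      linarith
    | succ k ih =>
      intro j ε hε
      rw [← map_add_atTop_eq_nat 1, eventually_map]
      filter_upwards [ih (j + 1) (ε / 2) (by positivity),
        (hδ j).eventually (gt_mem_nhds (show (0 : ℝ) < ε / 2 by positivity))] with t h1 h2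
      have h3 := mul_le_mul_of_nonneg_left h1 hα0
      have h4 : α * (ε / 2) ≤ 1 * (ε / 2) := by gcongr
      calc |e j (t + 1)| ≤ α * |e (j + 1) t| + δ j t := hrec j t
        _ ≤ α * (α ^ k * M + ε / 2) + ε / 2 := by linarith
        _ ≤ α ^ (k + 1) * M + ε := by rw [pow_succ]; nlinarith
  rw [Metric.tendsto_nhds]
  intro ε hε
  have hlim : Tendsto (fun k : ℕ => α ^ k * M) atTop (𝓝 (0 * M)) :=
    (tendsto_pow_atTop_nhds_zero_of_lt_one hα0 hα1).mul_const M
  rw [zero_mul] at hlim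
  obtain ⟨k, hk⟩ := (hlim.eventually (gt_mem_nhds (show (0 : ℝ) < ε / 2 by positivity))).exists
  filter_upwards [key k j (ε / 3) (by positivity)] with t ht
  rw [Real.dist_eq, sub_zero]
  linarith

lemma tendsto_div_natCast_succ {u : ℕ → ℝ} {l : ℝ}
    (h : Tendsto (fun t : ℕ => u t / t) atTop (𝓝 l)) :
    Tendsto (fun t : ℕ => u t / (t + 1 : ℕ)) atTop (𝓝 l) := by
  have h2 := h.mul (tendsto_natCast_div_add_atTop (1 : ℝ))
  rw [mul_one] at h2
  refine h2.congr' ?_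
  filter_upwards [eventually_gt_atTop 0] with t ht
  have : (0 : ℝ) < t := by exact_mod_cast ht
  push_cast
  field_simp

lemma tendsto_div_natCast_shift {u : ℕ → ℝ} {l : ℝ}
    (h : Tendsto (fun t : ℕ => u t / t) atTop (𝓝 l)) (j : ℕ) :
    Tendsto (fun t : ℕ => u (t + j) / t) atTop (𝓝 l) := by
  have h1 := (tendsto_add_atTop_iff_nat j).2 h
  have h2 := h1.div (tendsto_natCast_div_add_atTop (j : ℝ)) one_ne_zero
  rw [div_one] at h2
  refine h2.congr' ?_
  filter_upwards [eventually_gt_atTop 0] with t ht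
  have : (0 : ℝ) < t := by exact_mod_cast ht
  simp only [Pi.div_apply]
  push_cast
  field_simp

lemma tendsto_const_div_natCast_succ (C : ℝ) :
    Tendsto (fun t : ℕ => C / (t + 1 : ℕ)) atTop (𝓝 0) :=
  (tendsto_add_atTop_iff_nat (f := fun t : ℕ => C / (t : ℝ)) 1).2
    (tendsto_const_div_atTop_nhds_zero_nat C)

variable {H : Type*} [NormedAddCommGroup H] [InnerProductSpace ℝ H]

/-- Convexity of the squared norm at `α • p + (1 - α) • (κ / (1 - α)) • x`; the defect is exactly `α
/ (1 - α) * ‖(1 - α) • p - κ • x‖ ^ 2`. -/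
lemma norm_sq_convex_step (α κ : ℝ) (hα0 : 0 ≤ α) (hα1 : α < 1) (p x : H) :
    ‖α • p + κ • x‖ ^ 2 ≤ α * ‖p‖ ^ 2 + κ ^ 2 / (1 - α) * ‖x‖ ^ 2 := by
  have h1 : 0 < 1 - α := by linarith
  rw [norm_add_sq_real, norm_smul, norm_smul, inner_smul_left, inner_smul_right, mul_pow, mul_pow,
    Real.norm_eq_abs, Real.norm_eq_abs, sq_abs, sq_abs]
  have h2 := norm_sub_sq_real ((1 - α) • p) (κ • x)
  rw [norm_smul, norm_smul, inner_smul_left, inner_smul_right, mul_pow, mul_pow,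
    Real.norm_eq_abs, Real.norm_eq_abs, sq_abs, sq_abs] at h2
  simp only [conj_trivial] at h2 ⊢
  have h3 : 0 ≤ α / (1 - α) * ‖(1 - α) • p - κ • x‖ ^ 2 := by positivity
  rw [h2] at h3
  have h4 : α / (1 - α) * ((1 - α) ^ 2 * ‖p‖ ^ 2 - 2 * ((1 - α) * (κ * inner ℝ p x))
      + κ ^ 2 * ‖x‖ ^ 2) = α * (1 - α) * ‖p‖ ^ 2 - 2 * (α * (κ * inner ℝ p x))
      + (κ ^ 2 / (1 - α) - κ ^ 2) * ‖x‖ ^ 2 := by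
    field_simp
    ring
  rw [h4] at h3
  linarith

/-- Averages of the squared norms of an exponentially smoothed sequence, from the averages of the
autocorrelations of the sequence. -/
theorem tendsto_average_norm_sq_smoothed {x p : ℕ → H} {α κ V W : ℝ} (hα0 : 0 ≤ α) (hα1 : α < 1)
    (hp : ∀ s, p (s + 1) = α • p s + κ • x s)
    (hV : Tendsto (fun t : ℕ => (∑ s ∈ Finset.range t, ‖x s‖ ^ 2) / t) atTop (𝓝 V))
    (hW : ∀ j, Tendsto (fun t : ℕ => (∑ s ∈ Finset.range t, inner ℝ (x s) (x (s + (j + 1)))) / t)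
      atTop (𝓝 W)) :
    Tendsto (fun t : ℕ => (∑ s ∈ Finset.range t, ‖p (s + 1)‖ ^ 2) / t) atTop
      (𝓝 (κ ^ 2 / (1 - α ^ 2) * (V + 2 * α / (1 - α) * W))) := by
  have h1α : 0 < 1 - α := by linarith
  set K : ℝ := κ ^ 2 / (1 - α) with hK
  have hK0 : 0 ≤ K := by positivity
  have hstep : ∀ s, ‖p (s + 1)‖ ^ 2 ≤ α * ‖p s‖ ^ 2 + K * ‖x s‖ ^ 2 := fun s => by
    rw [hp s]; exact norm_sq_convex_step α κ hα0 hα1 (p s) (x s)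
  set P : ℕ → ℝ := fun t => ∑ s ∈ Finset.range t, ‖p s‖ ^ 2 with hP
  set Q : ℕ → ℝ := fun t => ∑ s ∈ Finset.range t, ‖x s‖ ^ 2 with hQ
  have hQ0 : ∀ t, 0 ≤ Q t := fun t => Finset.sum_nonneg fun _ _ => by positivity
  have hPsucc : ∀ t, P (t + 1) ≤ ‖p 0‖ ^ 2 + α * P t + K * Q t := by
    intro t
    simp only [hP, hQ]
    rw [Finset.sum_range_succ', Finset.mul_sum, Finset.mul_sum, add_comm, add_assoc,
      ← Finset.sum_add_distrib]
    gcongr with s hs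
    exact hstep s
  -- Monotonicity of `P` closes the recursive inequality: `P t ≤ P (t + 1)` lets `α * P t` be
  -- absorbed on the left.
  have hPle : ∀ t, P t ≤ (‖p 0‖ ^ 2 + K * Q t) / (1 - α) := by
    intro t
    rw [le_div_iff₀ h1α]
    have h1 := hPsucc t
    have h2 : P t ≤ P (t + 1) := by
      simp only [hP]; rw [Finset.sum_range_succ]; linarith [sq_nonneg ‖p t‖]
    linarith
  have hPavg : ∃ B : ℝ, ∀ᶠ t : ℕ in atTop, P t / t ≤ B := by
    have h1 : Tendsto (fun t : ℕ => (‖p 0‖ ^ 2 / t + K * (Q t / t)) / (1 - α)) atTop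
        (𝓝 ((0 + K * V) / (1 - α))) :=
      ((tendsto_const_div_atTop_nhds_zero_nat _).add (hV.const_mul K)).div_const _
    refine ⟨(0 + K * V) / (1 - α) + 1, ?_⟩
    filter_upwards [h1.eventually (gt_mem_nhds (lt_add_one _)), eventually_gt_atTop 0] with t ht ht0
    have ht0' : (0 : ℝ) < t := by exact_mod_cast ht0
    refine le_trans ?_ ht.le
    have h2 : (‖p 0‖ ^ 2 / t + K * (Q t / t)) / (1 - α)
        = (‖p 0‖ ^ 2 + K * Q t) / (1 - α) / t := by field_simp
    rw [h2]
    gcongr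
    exact hPle t
  obtain ⟨B, hB⟩ := hPavg
  have hP0 : ∀ t, 0 ≤ P t := fun t => Finset.sum_nonneg fun _ _ => by positivity
  -- the squared norms are negligible
  have hxsq : Tendsto (fun t : ℕ => ‖x t‖ ^ 2 / (t + 1 : ℕ)) atTop (𝓝 0) := by
    have h1 := (tendsto_add_atTop_iff_nat (f := fun t : ℕ => Q t / (t : ℝ)) 1).2 hV
    have h2 := h1.sub (tendsto_div_natCast_succ hV)
    rw [sub_self] at h2
    refine h2.congr fun t => ?_
    simp only [hQ]
    rw [Finset.sum_range_succ]
    ring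
  have hpsq : Tendsto (fun t : ℕ => ‖p t‖ ^ 2 / (t : ℝ)) atTop (𝓝 0) := by
    -- The index `j` is a dummy here. The quotient at `t = 0` is `0` by convention, so the extra
    -- term of `δ` pays for the passage from `0` to `1`. The bound `2 * B` comes from `‖p t‖ ^ 2 ≤ P
    -- (t + 1) ≤ B * (t + 1)` and `t ≥ 1`.
    refine tendsto_zero_of_abs_succ_le (e := fun _ t => ‖p t‖ ^ 2 / (t : ℝ))
      (δ := fun _ t => K * (‖x t‖ ^ 2 / (t + 1 : ℕ)) + (if t = 0 then ‖p 0‖ ^ 2 else 0)) (M := 2 * B)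
      hα0 hα1 ?_ ?_ ?_ 0
    · intro _ t
      rw [abs_of_nonneg (by positivity), abs_of_nonneg (by positivity)]
      have h1 : ‖p (t + 1)‖ ^ 2 / ((t + 1 : ℕ) : ℝ)
          ≤ (α * ‖p t‖ ^ 2 + K * ‖x t‖ ^ 2) / ((t + 1 : ℕ) : ℝ) := by
        gcongr; exact hstep t
      rcases Nat.eq_zero_or_pos t with rfl | ht
      · have : α * ‖p 0‖ ^ 2 ≤ 1 * ‖p 0‖ ^ 2 := by gcongr
        simp only [Nat.cast_zero, div_zero, zero_add, Nat.cast_one, div_one, mul_zero, if_true]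
          at h1 ⊢
        linarith
      · have ht' : (0 : ℝ) < t := by exact_mod_cast ht
        have h2 : α * ‖p t‖ ^ 2 / ((t + 1 : ℕ) : ℝ) ≤ α * ‖p t‖ ^ 2 / t := by
          gcongr; simp
        rw [if_neg ht.ne']
        rw [add_div] at h1
        rw [add_zero, ← mul_div_assoc, ← mul_div_assoc]
        linarith
    · intro _
      have h1 : Tendsto (fun t : ℕ => if t = 0 then ‖p 0‖ ^ 2 else 0) atTop (𝓝 (0 : ℝ)) := by
        refine tendsto_const_nhds.congr' ?_
        filter_upwards [eventually_gt_atTop 0] with t ht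
        rw [if_neg ht.ne']
      simpa using (hxsq.const_mul K).add h1
    · intro _
      have hB' := (tendsto_add_atTop_nat 1).eventually hB
      filter_upwards [hB', eventually_gt_atTop 0] with t h1 ht
      have ht' : (1 : ℝ) ≤ t := by exact_mod_cast ht
      rw [abs_of_nonneg (by positivity)]
      rw [div_le_iff₀ (by positivity)] at h1 ⊢
      have h2 : ‖p t‖ ^ 2 ≤ P (t + 1) := by
        have := hP0 t
        simp only [hP] at this ⊢; rw [Finset.sum_range_succ]; linarith
      have hB0 : 0 ≤ B := by
        by_contra hneg
        have := mul_neg_of_neg_of_pos (not_le.1 hneg) (show (0 : ℝ) < ((t + 1 : ℕ) : ℝ) by positivity)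
        linarith [hP0 (t + 1)]
      push_cast at h1
      nlinarith
  -- the averages of the correlations with the smoothed sequence
  set L : ℝ := κ * W / (1 - α) with hL
  set I : ℕ → ℕ → ℝ := fun j t => ∑ s ∈ Finset.range t, inner ℝ (p s) (x (s + j)) with hI
  set C : ℕ → ℕ → ℝ := fun j t => ∑ s ∈ Finset.range t, inner ℝ (x s) (x (s + (j + 1))) with hC
  -- Unfolding `p` once turns its correlation with `x` at lag `j` into the one at lag `j + 1`. The
  -- hierarchy never closes, but all lags share the limit `L`, the solution of `L = α * L + κ * W`.
  have hIrec : ∀ j t, I j (t + 1) = α * I (j + 1) t + κ * C j t + inner ℝ (p 0) (x j) := by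
    intro j t
    simp only [hI, hC]
    rw [Finset.sum_range_succ', Finset.mul_sum, Finset.mul_sum, ← Finset.sum_add_distrib, zero_add]
    congr 1
    refine Finset.sum_congr rfl fun s _ => ?_
    rw [hp s, inner_add_left, inner_smul_left, inner_smul_left, add_right_comm, add_assoc s j 1]
    simp
  have hIabs : ∀ j t, |I j t| ≤ (P t + Q (t + j)) / 2 := by
    intro j t
    have h1 : ∑ s ∈ Finset.range t, ‖x (s + j)‖ ^ 2 ≤ Q (t + j) := by
      simp only [hQ]
      rw [add_comm t j, Finset.sum_range_add]
      have : 0 ≤ ∑ s ∈ Finset.range j, ‖x s‖ ^ 2 := Finset.sum_nonneg fun _ _ => by positivity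
      simp only [add_comm j]
      linarith
    calc |I j t| ≤ ∑ s ∈ Finset.range t, |inner ℝ (p s) (x (s + j))| :=
          Finset.abs_sum_le_sum_abs _ _
      _ ≤ ∑ s ∈ Finset.range t, (‖p s‖ ^ 2 + ‖x (s + j)‖ ^ 2) / 2 := by
          gcongr with s hs
          have := abs_real_inner_le_norm (p s) (x (s + j))
          nlinarith [sq_nonneg (‖p s‖ - ‖x (s + j)‖)]
      _ = (P t + ∑ s ∈ Finset.range t, ‖x (s + j)‖ ^ 2) / 2 := by
          rw [← Finset.sum_div, Finset.sum_add_distrib]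
      _ ≤ _ := by gcongr
  have hIlim : Tendsto (fun t : ℕ => (I 0 t - L * t) / t) atTop (𝓝 0) := by
    refine tendsto_zero_of_abs_succ_le (e := fun j t => (I j t - L * t) / (t : ℝ))
      (δ := fun j t => |κ * (C j t / (t + 1 : ℕ)) - (1 - α) * L * (t / (t + 1 : ℕ))
        + (inner ℝ (p 0) (x j) - L) / (t + 1 : ℕ)|) (M := (B + (V + 1)) / 2 + |L|)
      hα0 hα1 ?_ ?_ ?_ 0
    · intro j t
      have h1 : (I j (t + 1) - L * (t + 1 : ℕ)) / (t + 1 : ℕ)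
          = α * ((I (j + 1) t - L * t) / (t + 1 : ℕ)) +
            (κ * (C j t / (t + 1 : ℕ)) - (1 - α) * L * (t / (t + 1 : ℕ))
            + (inner ℝ (p 0) (x j) - L) / (t + 1 : ℕ)) := by
        rw [hIrec j t]
        push_cast
        field_simp
        ring
      rw [h1]
      refine (abs_add_le _ _).trans (add_le_add_left ?_ _)
      rw [abs_mul, abs_of_nonneg hα0]
      gcongr α * ?_
      rcases Nat.eq_zero_or_pos t with rfl | ht
      · simp [hI]
      · have ht' : (0 : ℝ) < t := by exact_mod_cast ht
        rw [abs_div, abs_div, Nat.abs_cast, Nat.abs_cast]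
        gcongr
        simp
    · intro j
      have h1 := ((tendsto_div_natCast_succ (hW j)).const_mul κ).sub
        (((tendsto_natCast_div_add_atTop (1 : ℝ))).const_mul ((1 - α) * L))
      have h2 := (h1.add (tendsto_const_div_natCast_succ (inner ℝ (p 0) (x j) - L))).abs
      have h3 : κ * W - (1 - α) * L * 1 + 0 = 0 := by
        rw [hL]; field_simp; ring
      rw [h3, abs_zero] at h2
      refine h2.congr fun t => ?_
      simp only [hC, Nat.cast_add, Nat.cast_one]
    · intro j
      have h1 := (tendsto_div_natCast_shift hV j).eventually (gt_mem_nhds (lt_add_one V))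
      filter_upwards [h1, hB, eventually_gt_atTop 0] with t h2 h3 ht
      have ht' : (0 : ℝ) < t := by exact_mod_cast ht
      have h4 : (I j t - L * t) / t = I j t / t - L := by field_simp
      rw [h4]
      refine (abs_sub _ _).trans (add_le_add_left ?_ _)
      rw [abs_div, Nat.abs_cast]
      calc |I j t| / t ≤ (P t + Q (t + j)) / 2 / t := by gcongr; exact hIabs j t
        _ = (P t / t + Q (t + j) / t) / 2 := by ring
        _ ≤ _ := by gcongr
  have hIlim' : Tendsto (fun t : ℕ => I 0 t / t) atTop (𝓝 L) := by
    have h1 := hIlim.add_const L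
    rw [zero_add] at h1
    refine h1.congr' ?_
    filter_upwards [eventually_gt_atTop 0] with t ht
    have ht' : (0 : ℝ) < t := by exact_mod_cast ht
    field_simp
    ring
  have h1α2 : 0 < 1 - α ^ 2 := by nlinarith
  have hfin : Tendsto (fun t : ℕ => (α ^ 2 * (‖p 0‖ ^ 2 / t - ‖p t‖ ^ 2 / t)
      + 2 * α * κ * (I 0 t / t) + κ ^ 2 * (Q t / t)) / (1 - α ^ 2)) atTop
      (𝓝 ((α ^ 2 * (0 - 0) + 2 * α * κ * L + κ ^ 2 * V) / (1 - α ^ 2))) :=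
    ((((((tendsto_const_div_atTop_nhds_zero_nat _).sub hpsq).const_mul _).add
      (hIlim'.const_mul _)).add (hV.const_mul _)).div_const _)
  have hval : (α ^ 2 * (0 - 0) + 2 * α * κ * L + κ ^ 2 * V) / (1 - α ^ 2)
      = κ ^ 2 / (1 - α ^ 2) * (V + 2 * α / (1 - α) * W) := by
    rw [hL]; field_simp; ring
  rw [hval] at hfin
  refine hfin.congr fun t => ?_
  have hS1 : ∑ s ∈ Finset.range t, ‖p (s + 1)‖ ^ 2
      = α ^ 2 * P t + 2 * α * κ * I 0 t + κ ^ 2 * Q t := by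
    simp only [hP, hI, hQ, Finset.mul_sum, ← Finset.sum_add_distrib]
    refine Finset.sum_congr rfl fun s _ => ?_
    rw [hp s, norm_add_sq_real, norm_smul, norm_smul, inner_smul_left, inner_smul_right, mul_pow,
      mul_pow, Real.norm_eq_abs, Real.norm_eq_abs, sq_abs, sq_abs, add_zero]
    simp only [conj_trivial]
    ring
  -- The same sum was expanded in `hS1`; shifting the index here allows `P t` to be eliminated
  -- between the two.
  have hS2 : ∑ s ∈ Finset.range t, ‖p (s + 1)‖ ^ 2 = P t + ‖p t‖ ^ 2 - ‖p 0‖ ^ 2 := by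
    have h1 := Finset.sum_range_succ (fun s => ‖p s‖ ^ 2) t
    have h2 := Finset.sum_range_succ' (fun s => ‖p s‖ ^ 2) t
    simp only [hP]
    linarith
  rw [div_eq_iff h1α2.ne']
  have hS3 : (1 - α ^ 2) * ∑ s ∈ Finset.range t, ‖p (s + 1)‖ ^ 2
      = α ^ 2 * (‖p 0‖ ^ 2 - ‖p t‖ ^ 2) + 2 * α * κ * I 0 t + κ ^ 2 * Q t := by
    linear_combination hS1 - α ^ 2 * hS2
  calc _ = (α ^ 2 * (‖p 0‖ ^ 2 - ‖p t‖ ^ 2) + 2 * α * κ * I 0 t + κ ^ 2 * Q t) / t := by ring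
    _ = _ := by rw [← hS3]; ring

/-- The number of `s < t` congruent to `r` modulo `N` is the ceiling of `(t - r) / N`, written as a
floor. Passing from `t` to `t + 1` changes only the class of `t`. -/
lemma sum_range_eq_sum_residues (w : ℕ → ℝ) {N : ℕ} (hN : 0 < N) (t : ℕ) :
    ∑ s ∈ Finset.range t, w s
      = ∑ r ∈ Finset.range N, ∑ k ∈ Finset.range ((t + (N - 1 - r)) / N), w (r + N * k) := by
  induction t with
  | zero =>
    symm
    refine Finset.sum_eq_zero fun r hr => ?_
    rw [Nat.div_eq_of_lt (by omega)]
    simp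
  | succ t ih =>
    rw [Finset.sum_range_succ, ih]
    have hr : t % N ∈ Finset.range N := Finset.mem_range.2 (Nat.mod_lt _ hN)
    rw [← Finset.add_sum_erase _ _ hr, ← Finset.add_sum_erase _ _ hr]
    have h1 : (t + (N - 1 - t % N)) / N = t / N := by
      have := Nat.div_add_mod t N
      have := Nat.mod_lt t hN
      refine Nat.div_eq_of_lt_le ?_ ?_ <;> nlinarith [Nat.sub_add_cancel hN, Nat.mul_comm N (t / N), (by omega : N - 1 - t % N + t % N + 1 = N)]
    have h2 : (t + 1 + (N - 1 - t % N)) / N = t / N + 1 := by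
      have := Nat.div_add_mod t N
      have := Nat.mod_lt t hN
      refine Nat.div_eq_of_lt_le ?_ ?_ <;> nlinarith [Nat.mul_comm N (t / N), (by omega : N - 1 - t % N + t % N + 1 = N)]
    have h3 : ∀ r ∈ (Finset.range N).erase (t % N),
        (t + 1 + (N - 1 - r)) / N = (t + (N - 1 - r)) / N := by
      intro r hr
      rw [Finset.mem_erase, Finset.mem_range] at hr
      rw [add_right_comm, Nat.succ_div, if_neg, add_zero]
      intro hdvd
      apply hr.1
      have h4 : t + (N - 1 - r) + 1 + r = t + N := by omega
      have h5 : (t + (N - 1 - r) + 1 + r) % N = r % N := by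
        rw [Nat.add_mod, Nat.mod_eq_zero_of_dvd hdvd, zero_add, Nat.mod_mod]
      rw [h4, Nat.add_mod_right, Nat.mod_eq_of_lt hr.2] at h5
      exact h5.symm
    have h4 : ∑ r ∈ (Finset.range N).erase (t % N),
        ∑ k ∈ Finset.range ((t + 1 + (N - 1 - r)) / N), w (r + N * k) =
        ∑ r ∈ (Finset.range N).erase (t % N),
        ∑ k ∈ Finset.range ((t + (N - 1 - r)) / N), w (r + N * k) :=
      Finset.sum_congr rfl fun r hr => by rw [h3 r hr]
    rw [h4, h1, h2, Finset.sum_range_succ, Nat.mod_add_div]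
    ring

/-- If the averages along every residue class tend to `W`, so do the averages. -/
lemma tendsto_average_of_residues {w : ℕ → ℝ} {N : ℕ} (hN : 0 < N) {W : ℝ}
    (h : ∀ r < N, Tendsto (fun m : ℕ => (∑ k ∈ Finset.range m, w (r + N * k)) / m) atTop (𝓝 W)) :
    Tendsto (fun t : ℕ => (∑ s ∈ Finset.range t, w s) / t) atTop (𝓝 W) := by
  have hN' : (0 : ℝ) < N := by exact_mod_cast hN
  have hcount : ∀ i : ℕ, Tendsto (fun t : ℕ => (t + i) / N) atTop atTop := fun i =>
    (Nat.tendsto_div_const_atTop hN.ne').comp (tendsto_add_atTop_nat i)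
  have hratio : ∀ i : ℕ, Tendsto (fun t : ℕ => (((t + i) / N : ℕ) : ℝ) / t) atTop
      (𝓝 (1 / N)) := by
    intro i
    have h1 : Tendsto (fun t : ℕ => ((t : ℝ) / N - 1) / t) atTop (𝓝 (1 / N)) := by
      have h2 := (tendsto_const_nhds (x := 1 / (N : ℝ))).sub (tendsto_const_div_atTop_nhds_zero_nat 1)
      rw [sub_zero] at h2
      refine h2.congr' ?_
      filter_upwards [eventually_gt_atTop 0] with t ht
      have ht' : (0 : ℝ) < t := by exact_mod_cast ht
      field_simp
    have h3 : Tendsto (fun t : ℕ => (((t : ℝ) + i) / N) / t) atTop (𝓝 (1 / N)) := by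
      have h2 := (tendsto_const_nhds (x := 1 / (N : ℝ))).add
        (tendsto_const_div_atTop_nhds_zero_nat (i / N : ℝ))
      rw [add_zero] at h2
      refine h2.congr' ?_
      filter_upwards [eventually_gt_atTop 0] with t ht
      have ht' : (0 : ℝ) < t := by exact_mod_cast ht
      field_simp
    refine tendsto_of_tendsto_of_tendsto_of_le_of_le h1 h3 ?_ ?_
    · intro t
      dsimp only
      gcongr
      have h4 := Nat.lt_succ_floor (((t + i : ℕ) : ℝ) / N)
      rw [Nat.floor_div_eq_div, Nat.cast_succ, Nat.cast_add] at h4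
      have h5 : (t : ℝ) / N ≤ (t + i) / N := by gcongr; simp
      linarith
    · intro t
      dsimp only
      gcongr
      have := Nat.cast_div_le (α := ℝ) (m := t + i) (n := N)
      push_cast at this
      exact this
  have hsum : Tendsto (fun t : ℕ => ∑ r ∈ Finset.range N,
      ((∑ k ∈ Finset.range ((t + (N - 1 - r)) / N), w (r + N * k)) / ((t + (N - 1 - r)) / N : ℕ)) *
        (((t + (N - 1 - r)) / N : ℕ) / t)) atTop (𝓝 (∑ r ∈ Finset.range N, W * (1 / N))) :=
    tendsto_finsetSum _ fun r hr =>
      ((h r (Finset.mem_range.1 hr)).comp (hcount (N - 1 - r))).mul (hratio _)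
  have hval : ∑ r ∈ Finset.range N, W * (1 / N) = W := by
    rw [Finset.sum_const, Finset.card_range, nsmul_eq_mul]; field_simp
  rw [hval] at hsum
  refine hsum.congr fun t => ?_
  rw [sum_range_eq_sum_residues w hN t, Finset.sum_div]
  refine Finset.sum_congr rfl fun r _ => ?_
  rcases Nat.eq_zero_or_pos ((t + (N - 1 - r)) / N) with h0 | h0
  · rw [h0]; simp
  · have : (0 : ℝ) < ((t + (N - 1 - r)) / N : ℕ) := by exact_mod_cast h0
    rw [div_mul_div_comm, mul_comm _ (t : ℝ), mul_div_mul_right _ _ this.ne']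

end Averages

/-! ### Strong laws for squared norms and lagged inner products -/

section StrongLaw

variable {Ω : Type*} [MeasurableSpace Ω] {μ : Measure Ω} [IsProbabilityMeasure μ]

/-- Grouping an independent family indexed by pairs gives an independent family of families. -/
lemma iIndepFun_curry {ι κ 𝓧 : Type*} [MeasurableSpace 𝓧] {Y : ι → κ → Ω → 𝓧}
    (hY : ∀ i j, Measurable (Y i j)) (h : iIndepFun (fun q : ι × κ => Y q.1 q.2) μ) :
    iIndepFun (fun i ω j => Y i j ω) μ := by
  have hp : ∀ i j, IsProbabilityMeasure (μ.map (Y i j)) := fun i j =>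
    Measure.isProbabilityMeasure_map (hY i j).aemeasurable
  have hrow : ∀ i, iIndepFun (Y i) μ := fun i =>
    h.precomp (g := fun j => (i, j)) fun _ _ hj => (Prod.mk.inj hj).2
  rw [iIndepFun_iff_map_fun_eq_infinitePi_map fun i => measurable_pi_lambda _ (hY i)]
  have h1 : (fun ω i j => Y i j ω) = MeasurableEquiv.curry ι κ 𝓧 ∘ fun ω q => Y q.1 q.2 ω := by
    ext; simp
  rw [h1, ← Measure.map_map (MeasurableEquiv.measurable _)
    (measurable_pi_lambda (fun ω (q : ι × κ) => Y q.1 q.2 ω) fun q => hY q.1 q.2),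
    (iIndepFun_iff_map_fun_eq_infinitePi_map fun q : ι × κ => hY q.1 q.2).1 h,
    Measure.infinitePi_map_curry fun i j => μ.map (Y i j)]
  congr 1
  funext i
  rw [(iIndepFun_iff_map_fun_eq_infinitePi_map (hY i)).1 (hrow i)]

variable {E : Type*} [NormedAddCommGroup E] [InnerProductSpace ℝ E] [FiniteDimensional ℝ E]
  [MeasurableSpace E] [BorelSpace E]

lemma integrable_norm_sq_of_memLp {F : Type*} [NormedAddCommGroup F] {X : Ω → F}
    (hX : MemLp X 2 μ) : Integrable (fun ω => ‖X ω‖ ^ 2) μ :=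
  (memLp_two_iff_integrable_sq_norm hX.1).1 hX

lemma integrable_inner_of_memLp {X Y : Ω → E} (hX : MemLp X 2 μ) (hY : MemLp Y 2 μ) :
    Integrable (fun ω => (inner ℝ (X ω) (Y ω) : ℝ)) μ :=
  (hX.norm.integrable_mul hY.norm).mono (hX.1.inner hY.1)
    (Eventually.of_forall fun ω => by simpa using abs_real_inner_le_norm (X ω) (Y ω))

lemma integral_inner_of_indepFun {X Y : Ω → E} (h : IndepFun X Y μ)
    (hX : Integrable X μ) (hY : Integrable Y μ) :
    ∫ ω, inner ℝ (X ω) (Y ω) ∂μ = inner ℝ (∫ ω, X ω ∂μ) (∫ ω, Y ω ∂μ) :=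
  h.integral_bilin hX hY (innerSL ℝ)

variable {ξ : ℕ → Ω → E}

lemma ae_tendsto_average_norm_sq (hind : iIndepFun ξ μ)
    (hid : ∀ s, IdentDistrib (ξ s) (ξ 0) μ μ) (hL2 : MemLp (ξ 0) 2 μ) :
    ∀ᵐ ω ∂μ, Tendsto (fun t : ℕ => (∑ s ∈ Finset.range t, ‖ξ s ω‖ ^ 2) / t) atTop
      (𝓝 (∫ ω, ‖ξ 0 ω‖ ^ 2 ∂μ)) := by
  have hm : Measurable fun x : E => ‖x‖ ^ 2 := by fun_prop
  refine strong_law_ae_real (fun s ω => ‖ξ s ω‖ ^ 2) (integrable_norm_sq_of_memLp hL2) ?_ ?_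
  · exact fun s s' hs => (hind.indepFun hs).comp hm hm
  · exact fun s => (hid s).comp hm

/-- The empirical autocorrelations at a fixed positive lag of an i.i.d. sequence. -/
lemma ae_tendsto_average_inner_lag (hmeas : ∀ s, Measurable (ξ s)) (hind : iIndepFun ξ μ)
    (hid : ∀ s, IdentDistrib (ξ s) (ξ 0) μ μ) (hL2 : MemLp (ξ 0) 2 μ) :
    ∀ᵐ ω ∂μ, ∀ j : ℕ, Tendsto
      (fun t : ℕ => (∑ s ∈ Finset.range t, inner ℝ (ξ s ω) (ξ (s + (j + 1)) ω)) / t) atTop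
      (𝓝 (‖∫ ω, ξ 0 ω ∂μ‖ ^ 2)) := by
  rw [ae_all_iff]
  intro j
  have hm : Measurable fun x : E × E => (inner ℝ x.1 x.2 : ℝ) := by fun_prop
  have hL2s : ∀ s, MemLp (ξ s) 2 μ := fun s => (hid s).symm.memLp_snd hL2
  have hmean : ∀ s, ∫ ω, inner ℝ (ξ s ω) (ξ (s + (j + 1)) ω) ∂μ = ‖∫ ω, ξ 0 ω ∂μ‖ ^ 2 := by
    intro s
    rw [integral_inner_of_indepFun (hind.indepFun (by omega))
      ((hL2s _).integrable (by norm_num)) ((hL2s _).integrable (by norm_num)),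
      (hid s).integral_eq, (hid (s + (j + 1))).integral_eq, real_inner_self_eq_norm_sq]
  -- Products at a fixed lag are not independent, since pairs may share an index. Along a class
  -- modulo `2 * (j + 1)` the pairs `{s, s + j + 1}` are disjoint, so the strong law applies there.
  have hres : ∀ᵐ ω ∂μ, ∀ r : ℕ, Tendsto (fun m : ℕ => (∑ k ∈ Finset.range m,
      inner ℝ (ξ (r + 2 * (j + 1) * k) ω) (ξ (r + 2 * (j + 1) * k + (j + 1)) ω)) / m) atTop
      (𝓝 (‖∫ ω, ξ 0 ω ∂μ‖ ^ 2)) := by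
    rw [ae_all_iff]
    intro r
    have h1 := strong_law_ae_real (μ := μ) (fun k ω =>
      (inner ℝ (ξ (r + 2 * (j + 1) * k) ω) (ξ (r + 2 * (j + 1) * k + (j + 1)) ω) : ℝ)) ?_ ?_ ?_
    · rw [hmean] at h1
      exact h1
    · exact integrable_inner_of_memLp (hL2s _) (hL2s _)
    · intro k k' hk
      have hne : ∀ a b : ℕ, a ≠ b → 2 * (j + 1) * a ≠ 2 * (j + 1) * b := fun a b hab h =>
        hab (Nat.eq_of_mul_eq_mul_left (by omega) h)
      have hne' : ∀ a b : ℕ, 2 * (j + 1) * a + (j + 1) ≠ 2 * (j + 1) * b := by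
        intro a b h
        have h2 : (j + 1) * (2 * a + 1) = (j + 1) * (2 * b) := by linarith
        have := Nat.eq_of_mul_eq_mul_left (by omega) h2
        omega
      have := hne k k' hk
      have := hne' k k'
      have := hne' k' k
      exact (hind.indepFun_prodMk_prodMk hmeas (r + 2 * (j + 1) * k)
        (r + 2 * (j + 1) * k + (j + 1)) (r + 2 * (j + 1) * k')
        (r + 2 * (j + 1) * k' + (j + 1)) (by omega) (by omega) (by omega) (by omega)).comp hm hm
    · intro k
      exact (IdentDistrib.prodMk ((hid _).trans (hid _).symm) ((hid _).trans (hid _).symm)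
        (hind.indepFun (by omega)) (hind.indepFun (by omega))).comp hm
  filter_upwards [hres] with ω hω
  exact tendsto_average_of_residues (N := 2 * (j + 1)) (by omega) fun r _ => hω r

end StrongLaw

/-! ### The selected mutation vector and its first two moments -/

section BestStep

variable {E : Type*} [NormedAddCommGroup E] [InnerProductSpace ℝ E]

/-- The vector with the smallest component along `u` (the sum of them in case of ties). -/
noncomputable def bestStep {lam : ℕ} (u : E) (z : Fin lam → E) : E :=
  open Classical in
  ∑ i, if ∀ j, inner ℝ u (z i) ≤ inner ℝ u (z j) then z i else 0

lemma bestStep_eq {lam : ℕ} {u : E} {z : Fin lam → E}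
    (hz : ∀ i j, i ≠ j → (inner ℝ u (z i) : ℝ) ≠ inner ℝ u (z j)) {i : Fin lam}
    (hi : ∀ j, inner ℝ u (z i) ≤ inner ℝ u (z j)) : bestStep u z = z i := by
  unfold bestStep
  rw [Finset.sum_eq_single i, if_pos hi]
  · intro j _ hj
    rw [if_neg]
    exact fun h => hz j i hj (le_antisymm (h i) (hi j))
  · simp

/-- The component of `x` orthogonal to the unit vector `u`. -/
noncomputable def orthComponent (u : E) : E →L[ℝ] E :=
  ContinuousLinearMap.id ℝ E - (innerSL ℝ u).smulRight u

lemma orthComponent_apply (u x : E) : orthComponent u x = x - (inner ℝ u x : ℝ) • u := by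
  simp [orthComponent]

lemma norm_sq_orthComponent {u : E} (hu : ‖u‖ = 1) (x : E) :
    ‖orthComponent u x‖ ^ 2 = ‖x‖ ^ 2 - (inner ℝ u x : ℝ) ^ 2 := by
  rw [orthComponent_apply, norm_sub_sq_real, inner_smul_right, norm_smul, hu, real_inner_comm]
  simp
  ring

variable [FiniteDimensional ℝ E] [MeasurableSpace E] [BorelSpace E]

lemma measurable_bestStep {lam : ℕ} (u : E) :
    Measurable (bestStep u : (Fin lam → E) → E) := by
  classical
  unfold bestStep
  refine Finset.measurable_fun_sum _ fun i _ => ?_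
  refine Measurable.ite ?_ (measurable_pi_apply i) measurable_const
  rw [Set.ofPred_forall]
  refine MeasurableSet.iInter fun j => ?_
  exact measurableSet_le (by fun_prop) (by fun_prop)

lemma map_inner_stdGaussian {u : E} (hu : ‖u‖ = 1) :
    (stdGaussian E).map (fun x => (inner ℝ u x : ℝ)) = gaussianReal 0 1 := by
  have h := (IsGaussian.hasGaussianLaw_id (μ := stdGaussian E)).map (innerSL ℝ u)
  have h1 := h.map_eq_gaussianReal
  have h2 : (innerSL ℝ u) ∘ (id : E → E) = fun x => (inner ℝ u x : ℝ) := by ext; simp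
  have h3 : (fun x => (inner ℝ u x : ℝ)) = ⇑(innerSL ℝ u) := by ext; simp
  rw [h2] at h1
  rw [h1]
  rw [h3, integral_strongDual_stdGaussian, variance_dual_stdGaussian]
  simp [hu]

lemma integral_inner_mul_inner_stdGaussian (x y : E) :
    ∫ z, (inner ℝ x z : ℝ) * inner ℝ y z ∂(stdGaussian E) = inner ℝ x y := by
  have h := covarianceBilin_apply (IsGaussian.memLp_two_id (μ := stdGaussian E)) x y
  rw [covarianceBilin_stdGaussian] at h
  have h0 : (stdGaussian E)[id] = 0 := integral_id_stdGaussian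
  rw [h0] at h
  simp only [sub_zero] at h
  exact h.symm

lemma integral_norm_sq_stdGaussian :
    ∫ z, ‖z‖ ^ 2 ∂(stdGaussian E) = Module.finrank ℝ E := by
  have h1 : ∀ z : E, ‖z‖ ^ 2 = ∑ i, (inner ℝ (stdOrthonormalBasis ℝ E i) z : ℝ)
      * inner ℝ (stdOrthonormalBasis ℝ E i) z := by
    intro z
    rw [← (stdOrthonormalBasis ℝ E).sum_sq_norm_inner_right z]
    simp [sq]
  have hid : MemLp (fun z : E => z) 2 (stdGaussian E) := IsGaussian.memLp_two_id
  simp_rw [h1]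
  rw [integral_finsetSum]
  · simp_rw [integral_inner_mul_inner_stdGaussian]
    simp
  · exact fun i _ => (hid.const_inner _).integrable_mul (hid.const_inner _)

variable {Ω : Type*} [MeasurableSpace Ω] {μ : Measure Ω} [IsProbabilityMeasure μ]
  {lam : ℕ} {z : Fin lam → Ω → E}

/-- Two distinct projections have as joint law a product of atomless Gaussians, for which the
diagonal is null. Tie-breaking is therefore irrelevant. -/
lemma ae_inner_ne_of_iIndepFun (hlaw : ∀ i, HasLaw (z i) (stdGaussian E) μ) (hind : iIndepFun z μ)
    {u : E} (hu : ‖u‖ = 1) :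
    ∀ᵐ ω ∂μ, ∀ i j, i ≠ j → (inner ℝ u (z i ω) : ℝ) ≠ inner ℝ u (z j ω) := by
  rw [ae_all_iff]; intro i
  rw [ae_all_iff]; intro j
  by_cases hij : i = j
  · simp [hij]
  have hm : Measurable fun x : E => (inner ℝ u x : ℝ) := by fun_prop
  have hg : ∀ i, HasLaw (fun ω => (inner ℝ u (z i ω) : ℝ)) (gaussianReal 0 1) μ := fun i =>
    ⟨hm.comp_aemeasurable (hlaw i).aemeasurable, by
      rw [← map_inner_stdGaussian hu, ← (hlaw i).map_eq,
        AEMeasurable.map_map_of_aemeasurable hm.aemeasurable (hlaw i).aemeasurable]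
      rfl⟩
  have h1 : IndepFun (fun ω => (inner ℝ u (z i ω) : ℝ)) (fun ω => (inner ℝ u (z j ω) : ℝ)) μ :=
    (hind.indepFun hij).comp hm hm
  have h2 := (indepFun_iff_map_prod_eq_prod_map_map (hg i).aemeasurable (hg j).aemeasurable).1 h1
  rw [(hg i).map_eq, (hg j).map_eq] at h2
  have h3 : ∀ᵐ q ∂((gaussianReal 0 1).prod (gaussianReal 0 1)), q.1 ≠ q.2 := by
    refine (Measure.ae_prod_iff_ae_ae (p := fun q : ℝ × ℝ => q.1 ≠ q.2)
      (measurableSet_eq_fun measurable_fst measurable_snd).compl).2 ?_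
    refine Eventually.of_forall fun x => ?_
    have := nullSingletonClass_gaussianReal (μ := 0) (v := 1) one_ne_zero
    filter_upwards [compl_mem_ae_iff.2 (measure_singleton (μ := gaussianReal 0 1) x)] with y hy h
    exact hy h.symm
  rw [← h2] at h3
  filter_upwards [ae_of_ae_map ((hg i).aemeasurable.prodMk (hg j).aemeasurable) h3] with ω hω _
  exact hω

lemma hasLaw_iInf_inner (hlaw : ∀ i, HasLaw (z i) (stdGaussian E) μ) (hind : iIndepFun z μ)
    {u : E} (hu : ‖u‖ = 1) :
    HasLaw (fun ω => ⨅ i, (inner ℝ u (z i ω) : ℝ)) (minNormalLaw lam) μ := by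
  have hm : Measurable fun x : E => (inner ℝ u x : ℝ) := by fun_prop
  have hg : ∀ i, HasLaw (fun ω => (inner ℝ u (z i ω) : ℝ)) (gaussianReal 0 1) μ := fun i =>
    ⟨hm.comp_aemeasurable (hlaw i).aemeasurable, by
      rw [← map_inner_stdGaussian hu, ← (hlaw i).map_eq,
        AEMeasurable.map_map_of_aemeasurable hm.aemeasurable (hlaw i).aemeasurable]
      rfl⟩
  have h1 : iIndepFun (fun i ω => (inner ℝ u (z i ω) : ℝ)) μ := hind.comp _ fun _ => hm
  have h2 := (iIndepFun_iff_map_fun_eq_pi_map fun i => (hg i).aemeasurable).1 h1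
  simp_rw [(hg _).map_eq] at h2
  have hinf : Measurable fun x : Fin lam → ℝ => ⨅ i, x i :=
    Measurable.iInf fun i => measurable_pi_apply i
  have hae : AEMeasurable (fun ω i => (inner ℝ u (z i ω) : ℝ)) μ :=
    aemeasurable_pi_lambda _ fun i => (hg i).aemeasurable
  refine ⟨hinf.comp_aemeasurable hae, ?_⟩
  rw [minNormalLaw, ← h2, AEMeasurable.map_map_of_aemeasurable hinf.aemeasurable hae]
  rfl

/-- The components orthogonal to `u` are independent of the components along `u`. -/
lemma indepFun_orthComponent (hlaw : ∀ i, HasLaw (z i) (stdGaussian E) μ) (hind : iIndepFun z μ)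
    {u : E} (hu : ‖u‖ = 1) (i : Fin lam) :
    IndepFun (fun ω => orthComponent u (z i ω)) (fun ω j => (inner ℝ u (z j ω) : ℝ)) μ := by
  have hz : HasGaussianLaw (fun ω i => z i ω) μ :=
    hind.hasGaussianLaw fun i => (hlaw i).hasGaussianLaw
  have hL2 : ∀ i, MemLp (z i) 2 μ := fun i => (hlaw i).hasGaussianLaw.memLp_two
  -- The pair is a linear image of a Gaussian vector, so independence reduces to vanishing
  -- covariances.
  let T : (Fin lam → E) →L[ℝ] E × (Fin lam → ℝ) :=
    ((orthComponent u).comp (ContinuousLinearMap.proj i)).prod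
      (ContinuousLinearMap.pi fun j => (innerSL ℝ u).comp (ContinuousLinearMap.proj j))
  have hT : HasGaussianLaw (fun ω => (orthComponent u (z i ω),
      fun j => (inner ℝ u (z j ω) : ℝ))) μ := hz.map T
  refine hT.indepFun_of_covariance_strongDual fun L₁ L₂ => ?_
  have hL1 : L₁ ∘ (fun ω => orthComponent u (z i ω))
      = fun ω => (inner ℝ ((InnerProductSpace.toDual ℝ E).symm (L₁.comp (orthComponent u)))
        (z i ω) : ℝ) := by
    ext ω; simp
  set v := (InnerProductSpace.toDual ℝ E).symm (L₁.comp (orthComponent u)) with hv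
  -- `L₁` composed with the projection kills `u`; for `i = j` the covariance is precisely `⟨v, u⟩`.
  have huv : (inner ℝ v u : ℝ) = 0 := by
    rw [hv, InnerProductSpace.toDual_symm_apply]
    simp [orthComponent_apply, hu]
  have hL2' : L₂ ∘ (fun ω j => (inner ℝ u (z j ω) : ℝ))
      = fun ω => ∑ j, L₂ (Pi.single j 1) * (inner ℝ u (z j ω) : ℝ) := by
    ext ω
    refine (L₂.toLinearMap.pi_apply_eq_sum_univ (fun j => (inner ℝ u (z j ω) : ℝ))).trans ?_
    refine Finset.sum_congr rfl fun j _ => ?_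
    have h1 : (fun k => if j = k then (1 : ℝ) else 0) = Pi.single j 1 := by
      ext k; simp [Pi.single_apply, eq_comm]
    rw [h1, smul_eq_mul, mul_comm]
    rfl
  rw [hL1, hL2', covariance_fun_sum_right fun j => ((hL2 j).const_inner u).const_mul _]
  · refine Finset.sum_eq_zero fun j _ => ?_
    rw [covariance_const_mul_right]
    refine mul_eq_zero_of_right _ ?_
    by_cases hij : i = j
    · subst hij
      have hm : ∀ w : E, AEStronglyMeasurable (fun x : E => (inner ℝ w x : ℝ)) (μ.map (z i)) :=
        fun w => (by fun_prop : Measurable fun x : E => (inner ℝ w x : ℝ)).aestronglyMeasurable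
      have h1 := covariance_map_fun (hm v) (hm u) (hlaw i).aemeasurable
      rw [(hlaw i).map_eq] at h1
      rw [← h1, ← covarianceBilin_apply_eq_cov IsGaussian.memLp_two_id,
        covarianceBilin_stdGaussian]
      exact huv
    · exact ((hind.indepFun hij).comp (φ := fun x : E => (inner ℝ v x : ℝ))
        (ψ := fun x : E => (inner ℝ u x : ℝ)) (by fun_prop) (by fun_prop)).covariance_eq_zero
        ((hL2 i).const_inner v) ((hL2 j).const_inner u)
  · exact (hL2 i).const_inner v

lemma memLp_bestStep (hlaw : ∀ i, HasLaw (z i) (stdGaussian E) μ) (u : E) :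
    MemLp (fun ω => bestStep u fun i => z i ω) 2 μ := by
  have hL2 : ∀ i, MemLp (z i) 2 μ := fun i => (hlaw i).hasGaussianLaw.memLp_two
  have hae : AEMeasurable (fun ω i => z i ω) μ :=
    aemeasurable_pi_lambda _ fun i => (hlaw i).aemeasurable
  refine MemLp.mono' (g := fun ω => ∑ i, ‖z i ω‖)
    (memLp_finsetSum _ fun i _ => (hL2 i).norm)
    ((measurable_bestStep u).comp_aemeasurable hae).aestronglyMeasurable
    (Eventually.of_forall fun ω => ?_)
  refine (norm_sum_le _ _).trans (Finset.sum_le_sum fun i _ => ?_)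
  split_ifs <;> simp

/-- Functions of the orthogonal component of the selected vector have the expectation they have
for a standard Gaussian vector: the selection only looks at the components along `u`. -/
lemma integral_comp_orthComponent_bestStep {F : Type*} [NormedAddCommGroup F] [NormedSpace ℝ F]
    [CompleteSpace F] [MeasurableSpace F] [BorelSpace F] [SecondCountableTopology F]
    (hlam : 1 ≤ lam)
    (hlaw : ∀ i, HasLaw (z i) (stdGaussian E) μ) (hind : iIndepFun z μ)
    {u : E} (hu : ‖u‖ = 1) {φ : E → F} (hφ : Measurable φ)
    (hint : Integrable (fun x => φ (orthComponent u x)) (stdGaussian E)) :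
    ∫ ω, φ (orthComponent u (bestStep u fun i => z i ω)) ∂μ
      = ∫ x, φ (orthComponent u x) ∂(stdGaussian E) := by
  classical
  let A : Fin lam → Set (Fin lam → ℝ) := fun i => {x | ∀ j, x i ≤ x j}
  have hA : ∀ i, MeasurableSet (A i) := fun i => by
    simp only [A, Set.ofPred_forall]
    exact MeasurableSet.iInter fun j => measurableSet_le (by fun_prop) (by fun_prop)
  let G : Ω → Fin lam → ℝ := fun ω j => (inner ℝ u (z j ω) : ℝ)
  have hm : Measurable fun x : E => (inner ℝ u x : ℝ) := by fun_prop
  have hG : AEMeasurable G μ :=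
    aemeasurable_pi_lambda _ fun i => hm.comp_aemeasurable (hlaw i).aemeasurable
  have : Nonempty (Fin lam) := ⟨⟨0, hlam⟩⟩
  have hχ : ∀ i, Measurable ((A i).indicator fun _ => (1 : ℝ)) := fun i =>
    measurable_const.indicator (hA i)
  have hφQ : Measurable fun x => φ (orthComponent u x) := hφ.comp (by fun_prop)
  have hexi : ∀ ω, ∃ i, G ω ∈ A i := fun ω => by
    obtain ⟨i, hi⟩ := Finite.exists_min (G ω)
    exact ⟨i, hi⟩
  -- The selection events are almost surely a partition and depend only on components along `u`, so
  -- each indicator factors out of the expectation and the probabilities add up to one.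
  have hsel : ∀ᵐ ω ∂μ, (∑ i, (A i).indicator (fun _ => (1 : ℝ)) (G ω) = 1) ∧
      φ (orthComponent u (bestStep u fun i => z i ω))
        = ∑ i, (A i).indicator (fun _ => (1 : ℝ)) (G ω) • φ (orthComponent u (z i ω)) := by
    filter_upwards [ae_inner_ne_of_iIndepFun hlaw hind hu] with ω hω
    obtain ⟨i, hi⟩ := hexi ω
    have h1 : ∀ j ≠ i, G ω ∉ A j := fun j hj h => hω j i hj (le_antisymm (h i) (hi j))
    constructor
    · rw [Finset.sum_eq_single i]
      · rw [Set.indicator_of_mem hi]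
      · intro j _ hj
        rw [Set.indicator_of_notMem (h1 j hj)]
      · simp
    · rw [bestStep_eq (z := fun i => z i ω) hω hi, Finset.sum_eq_single i]
      · rw [Set.indicator_of_mem hi, one_smul]
      · intro j _ hj
        rw [Set.indicator_of_notMem (h1 j hj), zero_smul]
      · simp
  have hinti : ∀ i, Integrable (fun ω => φ (orthComponent u (z i ω))) μ := fun i => by
    have h1 := hint
    rw [← (hlaw i).map_eq] at h1
    exact h1.comp_aemeasurable (hlaw i).aemeasurable
  have hval : ∀ i, ∫ ω, φ (orthComponent u (z i ω)) ∂μ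
      = ∫ x, φ (orthComponent u x) ∂(stdGaussian E) := fun i => by
    rw [← (hlaw i).map_eq, integral_map (hlaw i).aemeasurable hφQ.aestronglyMeasurable]
  have hχint : ∀ i, Integrable (fun ω => (A i).indicator (fun _ => (1 : ℝ)) (G ω)) μ := fun i =>
    Integrable.of_bound ((hχ i).comp_aemeasurable hG).aestronglyMeasurable 1
      (Eventually.of_forall fun ω => by
        by_cases h : G ω ∈ A i <;> simp [h])
  have hindi : ∀ i, IndepFun (fun ω => (A i).indicator (fun _ => (1 : ℝ)) (G ω))
      (fun ω => φ (orthComponent u (z i ω))) μ := fun i =>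
    ((indepFun_orthComponent hlaw hind hu i).comp hφ (hχ i)).symm
  rw [integral_congr_ae (hsel.mono fun ω h => h.2), integral_finsetSum]
  · have h1 : ∀ i, ∫ ω, (A i).indicator (fun _ => (1 : ℝ)) (G ω) • φ (orthComponent u (z i ω)) ∂μ
        = (∫ ω, (A i).indicator (fun _ => (1 : ℝ)) (G ω) ∂μ)
          • ∫ x, φ (orthComponent u x) ∂(stdGaussian E) := fun i => by
      rw [(hindi i).integral_fun_smul_eq_smul_integral (hχint i).aestronglyMeasurable
        (hinti i).aestronglyMeasurable, hval i]
    simp_rw [h1]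
    rw [← Finset.sum_smul, ← integral_finsetSum _ fun i _ => hχint i,
      integral_congr_ae (hsel.mono fun ω h => h.1)]
    simp
  · intro i _
    refine (hinti i).mono (((hχ i).comp_aemeasurable hG).aestronglyMeasurable.smul
      (hinti i).aestronglyMeasurable) (Eventually.of_forall fun ω => ?_)
    by_cases h : G ω ∈ A i <;> simp [h]

lemma inner_bestStep_ae_eq (hlam : 1 ≤ lam) (hlaw : ∀ i, HasLaw (z i) (stdGaussian E) μ)
    (hind : iIndepFun z μ) {u : E} (hu : ‖u‖ = 1) :
    (fun ω => (inner ℝ u (bestStep u fun i => z i ω) : ℝ))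
      =ᵐ[μ] fun ω => ⨅ i, (inner ℝ u (z i ω) : ℝ) := by
  have : Nonempty (Fin lam) := ⟨⟨0, hlam⟩⟩
  filter_upwards [ae_inner_ne_of_iIndepFun hlaw hind hu] with ω hω
  obtain ⟨i, hi⟩ := Finite.exists_min fun i => (inner ℝ u (z i ω) : ℝ)
  rw [bestStep_eq (z := fun i => z i ω) hω hi]
  exact le_antisymm (le_ciInf hi) (ciInf_le (Set.finite_range _).bddBelow i)

lemma integral_inner_bestStep_pow (hlam : 1 ≤ lam) (hlaw : ∀ i, HasLaw (z i) (stdGaussian E) μ)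
    (hind : iIndepFun z μ) {u : E} (hu : ‖u‖ = 1) (k : ℕ) :
    ∫ ω, (inner ℝ u (bestStep u fun i => z i ω) : ℝ) ^ k ∂μ = minNormalMoment lam k := by
  have h := hasLaw_iInf_inner hlaw hind hu
  rw [minNormalMoment, ← h.map_eq, integral_map h.aemeasurable (by fun_prop)]
  refine integral_congr_ae ?_
  filter_upwards [inner_bestStep_ae_eq hlam hlaw hind hu] with ω hω
  rw [hω]

/-- Selection does not bias the orthogonal part, whose mean stays zero; only the mean of the
component along `u` remains. -/
lemma integral_bestStep (hlam : 1 ≤ lam) (hlaw : ∀ i, HasLaw (z i) (stdGaussian E) μ)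
    (hind : iIndepFun z μ) {u : E} (hu : ‖u‖ = 1) :
    ∫ ω, bestStep u (fun i => z i ω) ∂μ = minNormalMoment lam 1 • u := by
  have hint := (memLp_bestStep hlaw u).integrable (by norm_num)
  have hid : Integrable (fun x : E => x) (stdGaussian E) := IsGaussian.integrable_id
  have h1 := integral_comp_orthComponent_bestStep hlam hlaw hind hu measurable_id
    ((orthComponent u).integrable_comp hid)
  simp only [id] at h1
  rw [(orthComponent u).integral_comp_comm hint, (orthComponent u).integral_comp_comm hid,
    integral_id_stdGaussian, map_zero, orthComponent_apply, sub_eq_zero,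
    ← integral_inner hint] at h1
  rw [h1, ← integral_inner_bestStep_pow hlam hlaw hind hu]
  simp

/-- By Pythagoras: the orthogonal part keeps its Gaussian second moment, the dimension minus one,
and the component along `u` is the minimum. -/
lemma integral_norm_sq_bestStep (hlam : 1 ≤ lam) (hlaw : ∀ i, HasLaw (z i) (stdGaussian E) μ)
    (hind : iIndepFun z μ) {u : E} (hu : ‖u‖ = 1) :
    ∫ ω, ‖bestStep u (fun i => z i ω)‖ ^ 2 ∂μ
      = minNormalMoment lam 2 + (Module.finrank ℝ E - 1) := by
  have hL2 := memLp_bestStep hlaw u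
  have hid : MemLp (fun x : E => x) 2 (stdGaussian E) := IsGaussian.memLp_two_id
  have h1 := integral_comp_orthComponent_bestStep (φ := fun x : E => ‖x‖ ^ 2) hlam hlaw hind hu
    (by fun_prop) (integrable_norm_sq_of_memLp ((orthComponent u).comp_memLp' hid))
  simp only [norm_sq_orthComponent hu] at h1
  rw [integral_sub (integrable_norm_sq_of_memLp hL2) (hL2.const_inner u).integrable_sq,
    integral_sub (integrable_norm_sq_of_memLp hid) (hid.const_inner u).integrable_sq,
    integral_norm_sq_stdGaussian, integral_inner_bestStep_pow hlam hlaw hind hu] at h1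
  have h2 := integral_inner_mul_inner_stdGaussian u u
  rw [real_inner_self_eq_norm_sq, hu] at h2
  simp_rw [← sq] at h2
  rw [h2] at h1
  linarith

end BestStep

/-! ### Moments of the minimum of normals and positivity of the rate -/

section MinNormal

/-- With `q = P(N > r)`, this compares the tails of `|N|` and `|N_{1:lam}|`. At `lam = 3` the gap is
`q * (1 - q) * (1 - 2 * q)`, and it does not decrease with `lam` because `q ≤ 1 - q`. -/
lemma two_mul_lt_one_sub_pow_add_pow {q : ℝ} (hq0 : 0 < q) (hq1 : 2 * q < 1) {lam : ℕ}
    (h : 3 ≤ lam) : 2 * q < 1 - (1 - q) ^ lam + q ^ lam := by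
  obtain ⟨k, rfl⟩ := Nat.exists_eq_add_of_le h
  clear h
  induction k with
  | zero =>
    have h1 : 0 < q * (1 - 2 * q) * (1 - q) :=
      mul_pos (mul_pos hq0 (sub_pos.2 hq1)) (by linarith)
    rw [add_zero]
    linarith
  | succ k ih =>
    have h1 : q ^ (2 + k) ≤ (1 - q) ^ (2 + k) := by gcongr; linarith
    have h2 : 0 ≤ q * (1 - q) * ((1 - q) ^ (2 + k) - q ^ (2 + k)) :=
      mul_nonneg (mul_nonneg hq0.le (by linarith)) (sub_nonneg.2 h1)
    have h3 : 1 - (1 - q) ^ (3 + (k + 1)) + q ^ (3 + (k + 1))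
        = 1 - (1 - q) ^ (3 + k) + q ^ (3 + k)
          + q * (1 - q) * ((1 - q) ^ (2 + k) - q ^ (2 + k)) := by ring
    linarith

lemma gaussianReal_real_pos {s : Set ℝ} (hs : IsOpen s) (hne : s.Nonempty) :
    0 < (gaussianReal 0 1).real s := by
  rw [measureReal_def, ENNReal.toReal_pos_iff]
  refine ⟨pos_iff_ne_zero.2 fun h => ?_, measure_lt_top _ _⟩
  exact (hs.measure_pos volume hne).ne' (gaussianReal_absolutelyContinuous' 0 one_ne_zero h)

lemma gaussianReal_real_Iio_neg (r : ℝ) :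
    (gaussianReal 0 1).real (Set.Iio (-r)) = (gaussianReal 0 1).real (Set.Ioi r) := by
  have h := gaussianReal_map_neg (μ := 0) (v := 1)
  rw [neg_zero] at h
  conv_lhs => rw [← h]
  rw [map_measureReal_apply (by fun_prop) measurableSet_Iio]
  congr 1
  ext x
  simp

lemma gaussianReal_real_Ici_neg (r : ℝ) :
    (gaussianReal 0 1).real (Set.Ici (-r)) = 1 - (gaussianReal 0 1).real (Set.Ioi r) := by
  rw [← gaussianReal_real_Iio_neg, ← Set.compl_Iio, probReal_compl_eq_one_sub measurableSet_Iio]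

lemma gaussianReal_real_abs_gt {r : ℝ} (hr : 0 < r) :
    (gaussianReal 0 1).real {x | r < |x|} = 2 * (gaussianReal 0 1).real (Set.Ioi r) := by
  have h : {x : ℝ | r < |x|} = Set.Iio (-r) ∪ Set.Ioi r := by
    ext x
    simp only [Set.mem_ofPred_eq, lt_abs, Set.mem_union, Set.mem_Iio, Set.mem_Ioi]
    constructor <;> rintro (h | h)
    · exact Or.inr h
    · exact Or.inl (by linarith)
    · exact Or.inr (by linarith)
    · exact Or.inl h
  rw [h, measureReal_union _ measurableSet_Ioi, gaussianReal_real_Iio_neg]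
  · ring
  · rw [Set.disjoint_left]
    intro x hx hx'
    simp only [Set.mem_Iio, Set.mem_Ioi] at hx hx'
    linarith

lemma two_mul_gaussianReal_real_Ioi_lt_one {r : ℝ} (hr : 0 < r) :
    2 * (gaussianReal 0 1).real (Set.Ioi r) < 1 := by
  rw [← gaussianReal_real_abs_gt hr]
  have h1 : 0 < (gaussianReal 0 1).real (Set.Ioo (-r) r) :=
    gaussianReal_real_pos isOpen_Ioo (Set.nonempty_Ioo.2 (by linarith))
  have h2 : (gaussianReal 0 1).real {x | r < |x|}
      ≤ (gaussianReal 0 1).real (Set.Ioo (-r) r)ᶜ := by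
    refine measureReal_mono (fun x hx hx' => ?_)
    exact absurd (abs_lt.2 hx') (not_lt.2 (le_of_lt hx))
  rw [probReal_compl_eq_one_sub measurableSet_Ioo] at h2
  linarith

lemma measurable_iInf_fin (lam : ℕ) : Measurable fun x : Fin lam → ℝ => ⨅ i, x i :=
  Measurable.iInf fun i => measurable_pi_apply i

instance isProbabilityMeasure_minNormalLaw (lam : ℕ) :
    IsProbabilityMeasure (minNormalLaw lam) :=
  Measure.isProbabilityMeasure_map (measurable_iInf_fin lam).aemeasurable

/-- The minimum exceeds `r` in absolute value when some coordinate is below `-r` or all are above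
`r`. These events are disjoint, and symmetry expresses both through one tail. -/
lemma minNormalLaw_real_abs_gt {lam : ℕ} (hlam : 1 ≤ lam) {r : ℝ} (hr : 0 < r) :
    (minNormalLaw lam).real {x | r < |x|}
      = 1 - (1 - (gaussianReal 0 1).real (Set.Ioi r)) ^ lam
        + (gaussianReal 0 1).real (Set.Ioi r) ^ lam := by
  have : Nonempty (Fin lam) := ⟨⟨0, hlam⟩⟩
  have hpi : ∀ s : Set ℝ, (Measure.pi fun _ : Fin lam => gaussianReal 0 1).real
      (Set.univ.pi fun _ => s) = (gaussianReal 0 1).real s ^ lam := by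
    intro s
    rw [measureReal_def, Measure.pi_pi]
    simp [measureReal_def]
  have hset : (fun x : Fin lam → ℝ => ⨅ i, x i) ⁻¹' {x | r < |x|}
      = (Set.univ.pi fun _ => Set.Ici (-r))ᶜ ∪ Set.univ.pi fun _ => Set.Ioi r := by
    ext x
    obtain ⟨i, hi⟩ := Finite.exists_min x
    have hx : ⨅ i, x i = x i :=
      le_antisymm (ciInf_le (Set.finite_range _).bddBelow i) (le_ciInf hi)
    simp only [Set.mem_preimage, Set.mem_ofPred_eq, hx, Set.mem_union, Set.mem_compl_iff,
      Set.mem_pi, Set.mem_univ, Set.mem_Ici, Set.mem_Ioi, true_implies, not_forall, not_le, lt_abs]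
    constructor
    · rintro (h | h)
      · exact Or.inr fun j => h.trans_le (hi j)
      · exact Or.inl ⟨i, by linarith⟩
    · rintro (⟨j, hj⟩ | h)
      · exact Or.inr (by linarith [hi j])
      · exact Or.inl (h i)
  have hmeas : MeasurableSet {x : ℝ | r < |x|} := measurableSet_lt measurable_const (by fun_prop)
  rw [minNormalLaw, map_measureReal_apply (measurable_iInf_fin lam) hmeas, hset,
    measureReal_union _ (MeasurableSet.univ_pi fun _ => measurableSet_Ioi),
    probReal_compl_eq_one_sub (MeasurableSet.univ_pi fun _ => measurableSet_Ici), hpi, hpi,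
    gaussianReal_real_Ici_neg]
  rw [Set.disjoint_left]
  intro x hx hx'
  refine hx fun i hi => ?_
  have := hx' i hi
  simp only [Set.mem_Ioi, Set.mem_Ici] at this ⊢
  linarith

lemma lintegral_sq_eq_lintegral_abs_gt (ν : Measure ℝ) :
    ∫⁻ x, ENNReal.ofReal (x ^ 2) ∂ν = ∫⁻ t in Set.Ioi 0, ν {x | √t < |x|} := by
  rw [lintegral_eq_lintegral_meas_lt ν (Eventually.of_forall fun x => sq_nonneg x) (by fun_prop)]
  refine setLIntegral_congr_fun measurableSet_Ioi fun t ht => ?_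
  congr 1
  ext x
  exact (Real.sqrt_lt_sqrt_iff (le_of_lt ht)).symm.trans (by rw [Real.sqrt_sq_eq_abs]; rfl)

lemma memLp_eval_pi_gaussianReal {lam : ℕ} (i : Fin lam) :
    MemLp (fun x : Fin lam → ℝ => x i) 2 (Measure.pi fun _ : Fin lam => gaussianReal 0 1) :=
  (memLp_id_gaussianReal (μ := 0) (v := 1) 2).comp_measurePreserving
    (measurePreserving_eval (fun _ : Fin lam => gaussianReal 0 1) i)

lemma memLp_iInf_pi_gaussianReal {lam : ℕ} (hlam : 1 ≤ lam) :
    MemLp (fun x : Fin lam → ℝ => ⨅ i, x i) 2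
      (Measure.pi fun _ : Fin lam => gaussianReal 0 1) := by
  have : Nonempty (Fin lam) := ⟨⟨0, hlam⟩⟩
  refine MemLp.mono' (g := fun x => ∑ i, ‖x i‖)
    (memLp_finsetSum _ fun i _ => (memLp_eval_pi_gaussianReal i).norm)
    (measurable_iInf_fin lam).aestronglyMeasurable (Eventually.of_forall fun x => ?_)
  obtain ⟨i, hi⟩ := Finite.exists_min x
  have hx : ⨅ i, x i = x i :=
    le_antisymm (ciInf_le (Set.finite_range _).bddBelow i) (le_ciInf hi)
  rw [hx]
  exact Finset.single_le_sum (f := fun i => ‖x i‖) (fun _ _ => norm_nonneg _) (Finset.mem_univ i)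

lemma memLp_id_minNormalLaw {lam : ℕ} (hlam : 1 ≤ lam) :
    MemLp (fun x : ℝ => x) 2 (minNormalLaw lam) :=
  (memLp_map_measure_iff aestronglyMeasurable_id (measurable_iInf_fin lam).aemeasurable).2
    (memLp_iInf_pi_gaussianReal hlam)

lemma integral_sq_gaussianReal : ∫ x, x ^ 2 ∂(gaussianReal 0 1) = 1 := by
  have h := variance_eq_sub (memLp_id_gaussianReal (μ := 0) (v := 1) 2)
  rw [variance_id_gaussianReal] at h
  simpa using h.symm

lemma ofReal_integral_sq {ν : Measure ℝ} (hν : MemLp (fun x : ℝ => x) 2 ν) :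
    ENNReal.ofReal (∫ x, x ^ 2 ∂ν) = ∫⁻ t in Set.Ioi 0, ν {x | √t < |x|} := by
  rw [← lintegral_sq_eq_lintegral_abs_gt, ofReal_integral_eq_lintegral_ofReal hν.integrable_sq
    (Eventually.of_forall fun x => sq_nonneg x)]

/-- For `lam = 2` the tail `1 - (1 - q) ^ 2 + q ^ 2` is `2 * q`, that of `|N|`; the layer-cake
formula then equates the second moments. -/
lemma minNormalMoment_two_two : minNormalMoment 2 2 = 1 := by
  have h1 := ofReal_integral_sq (memLp_id_minNormalLaw (lam := 2) (by norm_num))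
  have h2 := ofReal_integral_sq (memLp_id_gaussianReal (μ := 0) (v := 1) 2)
  rw [integral_sq_gaussianReal] at h2
  have h3 : ∫⁻ t in Set.Ioi 0, (minNormalLaw 2) {x | √t < |x|}
      = ∫⁻ t in Set.Ioi 0, (gaussianReal 0 1) {x | √t < |x|} := by
    refine setLIntegral_congr_fun measurableSet_Ioi fun t ht => ?_
    have hr : 0 < √t := Real.sqrt_pos.2 ht
    have h4 : (minNormalLaw 2).real {x | √t < |x|} = (gaussianReal 0 1).real {x | √t < |x|} := by
      rw [minNormalLaw_real_abs_gt (by norm_num) hr, gaussianReal_real_abs_gt hr]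
      ring
    exact (measureReal_eq_measureReal_iff).1 h4
  rw [h3, ← h2] at h1
  exact (ENNReal.ofReal_eq_ofReal_iff (integral_nonneg fun x => sq_nonneg x) zero_le_one).1 h1

lemma one_lt_minNormalMoment_two {lam : ℕ} (hlam : 3 ≤ lam) : 1 < minNormalMoment lam 2 := by
  have h1 := ofReal_integral_sq (memLp_id_minNormalLaw (lam := lam) (by omega))
  have h2 := ofReal_integral_sq (memLp_id_gaussianReal (μ := 0) (v := 1) 2)
  rw [integral_sq_gaussianReal] at h2
  -- Monotonicity of the tail supplies the measurability needed to integrate the strict inequality.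
  have hanti : Antitone fun t : ℝ => (minNormalLaw lam) {x | √t < |x|} := fun s t hst =>
    measure_mono fun x hx => lt_of_le_of_lt (Real.sqrt_le_sqrt hst) hx
  have h3 : ∫⁻ t in Set.Ioi 0, (gaussianReal 0 1) {x | √t < |x|}
      < ∫⁻ t in Set.Ioi 0, (minNormalLaw lam) {x | √t < |x|} := by
    refine setLIntegral_strict_mono measurableSet_Ioi (by simp) hanti.measurable
      (by rw [← h2]; exact ENNReal.ofReal_ne_top) (Eventually.of_forall fun t ht => ?_)
    have hr : 0 < √t := Real.sqrt_pos.2 ht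
    have h4 : (gaussianReal 0 1).real {x | √t < |x|} < (minNormalLaw lam).real {x | √t < |x|} := by
      rw [minNormalLaw_real_abs_gt (by omega) hr, gaussianReal_real_abs_gt hr]
      exact two_mul_lt_one_sub_pow_add_pow (gaussianReal_real_pos isOpen_Ioi Set.nonempty_Ioi)
        (two_mul_gaussianReal_real_Ioi_lt_one hr) hlam
    exact (ENNReal.toReal_lt_toReal (measure_ne_top _ _) (measure_ne_top _ _)).1 h4
  rw [← h2, ← h1] at h3
  exact (ENNReal.ofReal_lt_ofReal_iff_of_nonneg zero_le_one).1 h3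

/-- If the minimum had mean zero like each coordinate, the nonnegative differences `x i - ⨅ i, x i`
would vanish almost everywhere and both coordinates would agree. The quadrant `x 0 < 0 < x 1` has
positive measure. -/
lemma minNormalMoment_two_one_ne_zero : minNormalMoment 2 1 ≠ 0 := by
  intro h
  set π := Measure.pi fun _ : Fin 2 => gaussianReal 0 1 with hπ
  have hm : ∫ x, (⨅ i, x i) ∂π = 0 := by
    rw [minNormalMoment, minNormalLaw, integral_map (measurable_iInf_fin 2).aemeasurable
      (by fun_prop)] at h
    simpa using h
  have hint := (memLp_iInf_pi_gaussianReal (lam := 2) (by norm_num)).integrable one_le_two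
  have hae : ∀ i, (fun x : Fin 2 → ℝ => x i - ⨅ i, x i) =ᵐ[π] 0 := by
    intro i
    have hi := (memLp_eval_pi_gaussianReal i).integrable one_le_two
    rw [← integral_eq_zero_iff_of_nonneg]
    · rw [integral_sub hi hint, hm, sub_zero]
      have := integral_map (μ := π) (φ := fun x : Fin 2 → ℝ => x i)
        (measurable_pi_apply i).aemeasurable (f := fun x : ℝ => x) (by fun_prop)
      rw [← this]
      have h2 : π.map (fun x : Fin 2 → ℝ => x i) = gaussianReal 0 1 :=
        (measurePreserving_eval (fun _ : Fin 2 => gaussianReal 0 1) i).map_eq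
      rw [h2, integral_id_gaussianReal]
    · exact fun x => sub_nonneg.2 (ciInf_le (Set.finite_range _).bddBelow i)
    · exact hi.sub hint
  have heq : ∀ᵐ x ∂π, x 0 = x 1 := by
    filter_upwards [hae 0, hae 1] with x h0 h1
    simp only [Pi.zero_apply] at h0 h1
    linarith
  have hnull : π (Set.univ.pi ![Set.Iio 0, Set.Ioi 0]) = 0 := by
    refine measure_mono_null (fun x hx => ?_) (ae_iff.1 heq)
    intro hx'
    have h0 := hx 0 (Set.mem_univ _)
    have h1 := hx 1 (Set.mem_univ _)
    simp only [Matrix.cons_val_zero, Matrix.cons_val_one, Set.mem_Iio, Set.mem_Ioi] at h0 h1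
    linarith
  rw [hπ, Measure.pi_pi, Fin.prod_univ_two, mul_eq_zero] at hnull
  rcases hnull with h0 | h0
  · exact (gaussianReal_real_pos (isOpen_Iio (a := (0 : ℝ))) Set.nonempty_Iio).ne'
      (by rw [measureReal_def]; simpa using congrArg ENNReal.toReal h0)
  · exact (gaussianReal_real_pos (isOpen_Ioi (a := (0 : ℝ))) Set.nonempty_Ioi).ne'
      (by rw [measureReal_def]; simpa using congrArg ENNReal.toReal h0)

/-- For `lam ≥ 3` the second-moment term is already positive, even at `c = 1`. For `lam = 2` it
vanishes, and positivity rests on the squared mean, with weight `1 - c`. -/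
lemma csaRate_pos {n lam : ℕ} (hn : 0 < n) {c d : ℝ} (hc0 : 0 < c) (hc1 : c ≤ 1) (hd : 0 < d)
    (h : 3 ≤ lam ∨ (lam = 2 ∧ c < 1)) : 0 < csaRate n lam c d := by
  have hn' : (0 : ℝ) < n := by exact_mod_cast hn
  refine mul_pos (by positivity) ?_
  rcases h with h | ⟨rfl, h⟩
  · have h1 := mul_pos hc0 (sub_pos.2 (one_lt_minNormalMoment_two h))
    have h2 : 0 ≤ 2 * (1 - c) * minNormalMoment lam 1 ^ 2 :=
      mul_nonneg (by linarith) (sq_nonneg _)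
    linarith
  · have h1 := sq_pos_of_ne_zero minNormalMoment_two_one_ne_zero
    have h2 : 0 < 1 - c := by linarith
    rw [minNormalMoment_two_two, sub_self, mul_zero, add_zero]
    positivity

end MinNormal

/-! ### Smoothing an i.i.d. sequence, almost surely and in `L²` -/

section SquareIntegrable

variable {Ω : Type*} [MeasurableSpace Ω] {μ : Measure Ω}
  {E : Type*} [NormedAddCommGroup E] [InnerProductSpace ℝ E]

lemma inner_toLp_toLp {X Y : Ω → E} (hX : MemLp X 2 μ) (hY : MemLp Y 2 μ) :
    inner ℝ (hX.toLp X) (hY.toLp Y) = ∫ ω, (inner ℝ (X ω) (Y ω) : ℝ) ∂μ := by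
  rw [L2.inner_def]
  refine integral_congr_ae ?_
  filter_upwards [hX.coeFn_toLp, hY.coeFn_toLp] with ω h1 h2
  rw [h1, h2]

lemma norm_sq_toLp {X : Ω → E} (hX : MemLp X 2 μ) :
    ‖hX.toLp X‖ ^ 2 = ∫ ω, ‖X ω‖ ^ 2 ∂μ := by
  rw [← real_inner_self_eq_norm_sq, inner_toLp_toLp]
  simp only [real_inner_self_eq_norm_sq]

variable [FiniteDimensional ℝ E] [MeasurableSpace E] [BorelSpace E] [IsProbabilityMeasure μ]
  {ξ p : ℕ → Ω → E} {α κ : ℝ}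

lemma memLp_smoothed (hξ : ∀ s, MemLp (ξ s) 2 μ) (hp0 : MemLp (p 0) 2 μ)
    (hp : ∀ᵐ ω ∂μ, ∀ s, p (s + 1) ω = α • p s ω + κ • ξ s ω) (s : ℕ) : MemLp (p s) 2 μ := by
  induction s with
  | zero => exact hp0
  | succ s ih =>
    refine (memLp_congr_ae ?_).2 ((ih.const_smul α).add ((hξ s).const_smul κ))
    filter_upwards [hp] with ω hω
    exact hω s

/-- Exponential smoothing of an i.i.d. square integrable sequence: almost sure limit of the
averages of the squared norms. -/
lemma ae_tendsto_average_norm_sq_smoothed (hmeas : ∀ s, Measurable (ξ s)) (hind : iIndepFun ξ μ)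
    (hid : ∀ s, IdentDistrib (ξ s) (ξ 0) μ μ) (hL2 : MemLp (ξ 0) 2 μ) (hα0 : 0 ≤ α) (hα1 : α < 1)
    (hp : ∀ᵐ ω ∂μ, ∀ s, p (s + 1) ω = α • p s ω + κ • ξ s ω) :
    ∀ᵐ ω ∂μ, Tendsto (fun t : ℕ => (∑ s ∈ Finset.range t, ‖p (s + 1) ω‖ ^ 2) / t) atTop
      (𝓝 (κ ^ 2 / (1 - α ^ 2) *
        (∫ ω, ‖ξ 0 ω‖ ^ 2 ∂μ + 2 * α / (1 - α) * ‖∫ ω, ξ 0 ω ∂μ‖ ^ 2))) := by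
  filter_upwards [hp, ae_tendsto_average_norm_sq hind hid hL2,
    ae_tendsto_average_inner_lag hmeas hind hid hL2] with ω h1 h2 h3
  exact tendsto_average_norm_sq_smoothed (x := fun s => ξ s ω) (p := fun s => p s ω)
    hα0 hα1 h1 h2 h3

/-- Exponential smoothing of an i.i.d. square integrable sequence: limit of the averages of the
expected squared norms. -/
lemma tendsto_average_integral_norm_sq_smoothed (hind : iIndepFun ξ μ)
    (hid : ∀ s, IdentDistrib (ξ s) (ξ 0) μ μ) (hL2 : MemLp (ξ 0) 2 μ) (hα0 : 0 ≤ α) (hα1 : α < 1)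
    (hp0 : MemLp (p 0) 2 μ)
    (hp : ∀ᵐ ω ∂μ, ∀ s, p (s + 1) ω = α • p s ω + κ • ξ s ω) :
    Tendsto (fun t : ℕ => (∑ s ∈ Finset.range t, ∫ ω, ‖p (s + 1) ω‖ ^ 2 ∂μ) / t) atTop
      (𝓝 (κ ^ 2 / (1 - α ^ 2) *
        (∫ ω, ‖ξ 0 ω‖ ^ 2 ∂μ + 2 * α / (1 - α) * ‖∫ ω, ξ 0 ω ∂μ‖ ^ 2))) := by
  have hξ : ∀ s, MemLp (ξ s) 2 μ := fun s => (hid s).symm.memLp_snd hL2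
  have hpL := memLp_smoothed hξ hp0 hp
  have hnorm : ∀ s, ‖(hξ s).toLp (ξ s)‖ ^ 2 = ∫ ω, ‖ξ 0 ω‖ ^ 2 ∂μ := fun s => by
    rw [norm_sq_toLp]
    exact ((hid s).comp (u := fun x : E => ‖x‖ ^ 2) (by fun_prop)).integral_eq
  have hinner : ∀ s j, inner ℝ ((hξ s).toLp (ξ s)) ((hξ (s + (j + 1))).toLp (ξ (s + (j + 1))))
      = ‖∫ ω, ξ 0 ω ∂μ‖ ^ 2 := fun s j => by
    rw [inner_toLp_toLp, integral_inner_of_indepFun (hind.indepFun (by omega))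
      ((hξ _).integrable one_le_two) ((hξ _).integrable one_le_two),
      (hid s).integral_eq, (hid (s + (j + 1))).integral_eq, real_inner_self_eq_norm_sq]
  have hconst : ∀ C : ℝ, Tendsto (fun t : ℕ => (∑ _s ∈ Finset.range t, C) / t) atTop (𝓝 C) := by
    intro C
    refine tendsto_const_nhds.congr' ?_
    filter_upwards [eventually_gt_atTop 0] with t ht
    have ht' : (0 : ℝ) < t := by exact_mod_cast ht
    rw [Finset.sum_const, Finset.card_range, nsmul_eq_mul]
    field_simp
  -- The ambient space is now `L²(μ; E)`: squared norms are expectations, and independence makes the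
  -- correlations at every positive lag equal to the squared norm of the mean.
  have h := tendsto_average_norm_sq_smoothed (x := fun s => (hξ s).toLp (ξ s))
    (p := fun s => (hpL s).toLp (p s)) (α := α) (κ := κ) (V := ∫ ω, ‖ξ 0 ω‖ ^ 2 ∂μ)
    (W := ‖∫ ω, ξ 0 ω ∂μ‖ ^ 2) hα0 hα1 ?_ ?_ ?_
  · simpa only [norm_sq_toLp] using h
  · intro s
    rw [← MemLp.toLp_const_smul, ← MemLp.toLp_const_smul, ← MemLp.toLp_add]
    refine MemLp.toLp_congr _ _ ?_
    filter_upwards [hp] with ω hω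
    exact hω s
  · simpa only [hnorm] using hconst _
  · intro j
    simpa only [hinner] using hconst _

end SquareIntegrable

/-! ### The selected steps as an i.i.d. sequence -/

/-- For i.i.d. standard Gaussian mutation vectors, the selected steps agree almost surely with a
measurable i.i.d. square integrable sequence. -/
lemma exists_iid_bestStep {E : Type*} [NormedAddCommGroup E] [InnerProductSpace ℝ E]
    [FiniteDimensional ℝ E] [MeasurableSpace E] [BorelSpace E] {Ω : Type*} [MeasurableSpace Ω]
    {μ : Measure Ω} [IsProbabilityMeasure μ] {lam : ℕ} (hlam : 1 ≤ lam) {Z : ℕ → Fin lam → Ω → E}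
    (hZ_law : ∀ t i, HasLaw (Z t i) (stdGaussian E) μ)
    (hZ_indep : iIndepFun (fun q : ℕ × Fin lam => Z q.1 q.2) μ) {u : E} (hu : ‖u‖ = 1) :
    ∃ ξ : ℕ → Ω → E, (∀ t, Measurable (ξ t)) ∧ iIndepFun ξ μ ∧
      (∀ t, IdentDistrib (ξ t) (ξ 0) μ μ) ∧ MemLp (ξ 0) 2 μ ∧
      ∫ ω, ‖ξ 0 ω‖ ^ 2 ∂μ = minNormalMoment lam 2 + (Module.finrank ℝ E - 1) ∧
      ∫ ω, ξ 0 ω ∂μ = minNormalMoment lam 1 • u ∧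
      ∀ᵐ ω ∂μ, ∀ t, (∀ i j, i ≠ j → (inner ℝ u (Z t i ω) : ℝ) ≠ inner ℝ u (Z t j ω)) ∧
        bestStep u (fun i => Z t i ω) = ξ t ω := by
  -- measurable versions of the mutation vectors
  let Y : ℕ → Fin lam → Ω → E := fun t i =>
    (hZ_law t i).aemeasurable.mk (Z t i)
  have hYm : ∀ t i, Measurable (Y t i) := fun t i => (hZ_law t i).aemeasurable.measurable_mk
  have hYZ : ∀ t i, Z t i =ᵐ[μ] Y t i := fun t i => (hZ_law t i).aemeasurable.ae_eq_mk
  have hYlaw : ∀ t i, HasLaw (Y t i) (stdGaussian E) μ := fun t i =>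
    (hZ_law t i).congr (hYZ t i).symm
  have hYind : iIndepFun (fun q : ℕ × Fin lam => Y q.1 q.2) μ :=
    (iIndepFun_congr fun q : ℕ × Fin lam => hYZ q.1 q.2).1 hZ_indep
  have hYrow : ∀ t, iIndepFun (Y t) μ := fun t =>
    hYind.precomp (g := fun j => (t, j)) fun _ _ hj => (Prod.mk.inj hj).2
  have hYvec : iIndepFun (fun t ω i => Y t i ω) μ := iIndepFun_curry hYm hYind
  have hYid : ∀ t, IdentDistrib (fun ω i => Y t i ω) (fun ω i => Y 0 i ω) μ μ := fun t =>
    ⟨(measurable_pi_lambda _ (hYm t)).aemeasurable, (measurable_pi_lambda _ (hYm 0)).aemeasurable,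
      by
        rw [(iIndepFun_iff_map_fun_eq_pi_map fun i => (hYm t i).aemeasurable).1 (hYrow t),
          (iIndepFun_iff_map_fun_eq_pi_map fun i => (hYm 0 i).aemeasurable).1 (hYrow 0)]
        simp_rw [(hYlaw _ _).map_eq]⟩
  -- the selected steps
  let ξ : ℕ → Ω → E := fun t ω => bestStep u fun i => Y t i ω
  have hξm : ∀ t, Measurable (ξ t) := fun t =>
    (measurable_bestStep u).comp (measurable_pi_lambda _ (hYm t))
  have hξind : iIndepFun ξ μ := hYvec.comp _ fun _ => measurable_bestStep u
  have hξid : ∀ t, IdentDistrib (ξ t) (ξ 0) μ μ := fun t => (hYid t).comp (measurable_bestStep u)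
  refine ⟨ξ, hξm, hξind, hξid, memLp_bestStep (hYlaw 0) u,
    integral_norm_sq_bestStep hlam (hYlaw 0) (hYrow 0) hu,
    integral_bestStep hlam (hYlaw 0) (hYrow 0) hu, ?_⟩
  filter_upwards [ae_all_iff.2 fun t => ae_all_iff.2 fun i => hYZ t i,
    ae_all_iff.2 fun t => ae_inner_ne_of_iIndepFun (hYlaw t) (hYrow t) hu] with ω h1 h2 t
  have h3 : (fun i => Z t i ω) = fun i => Y t i ω := funext fun i => h1 t i
  refine ⟨fun i j hij => ?_, by rw [h3]⟩
  rw [h1 t i, h1 t j]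
  exact h2 t i j hij

/-! ### Runs of the algorithm -/

section Run

variable {n lam : ℕ} {f : EuclideanSpace ℝ (Fin n) → ℝ} {c d : ℝ}
  {z : ℕ → Fin lam → EuclideanSpace ℝ (Fin n)} {X : ℕ → EuclideanSpace ℝ (Fin n)} {σ : ℕ → ℝ}
  {p : ℕ → EuclideanSpace ℝ (Fin n)}

lemma IsCSARun.stepSize_pos (h : IsCSARun f c d z X σ p) (t : ℕ) : 0 < σ t := by
  induction t with
  | zero => exact h.stepSize_zero_pos
  | succ t ih => rw [h.stepSize_succ t]; positivity

lemma IsCSARun.log_stepSize_div (h : IsCSARun f c d z X σ p) (t : ℕ) :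
    Real.log (σ t / σ 0)
      = c / (2 * d) * ((∑ s ∈ Finset.range t, ‖p (s + 1)‖ ^ 2) / n - t) := by
  rw [Real.log_div (h.stepSize_pos t).ne' (h.stepSize_pos 0).ne']
  induction t with
  | zero => simp
  | succ t ih =>
    rw [h.stepSize_succ t, Real.log_mul (h.stepSize_pos t).ne' (Real.exp_pos _).ne', Real.log_exp,
      Finset.sum_range_succ, add_sub_right_comm, ih]
    push_cast
    ring

/-- On a strictly increasing function of a linear form, the path is moved by the mutation vector
with the smallest component along the gradient direction. -/
lemma IsCSARun.path_succ (h : IsCSARun f c d z X σ p) {g : ℝ → ℝ} (hg : StrictMono g)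
    {a : EuclideanSpace ℝ (Fin n)} (ha : a ≠ 0) {b : ℝ} (hf : ∀ x, f x = g (inner ℝ a x + b))
    (t : ℕ)
    (hz : ∀ i j, i ≠ j → (inner ℝ (‖a‖⁻¹ • a) (z t i) : ℝ) ≠ inner ℝ (‖a‖⁻¹ • a) (z t j)) :
    p (t + 1) = (1 - c) • p t + √(c * (2 - c)) • bestStep (‖a‖⁻¹ • a) (z t) := by
  obtain ⟨i, hi, -, hp⟩ := h.select t
  rw [hp, bestStep_eq hz (i := i)]
  intro j
  have h1 := hi j
  rw [hf, hf, hg.le_iff_le, inner_add_right, inner_add_right, inner_smul_right,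
    inner_smul_right] at h1
  have h2 : (inner ℝ a (z t i) : ℝ) ≤ inner ℝ a (z t j) :=
    le_of_mul_le_mul_left (by linarith) (h.stepSize_pos t)
  rw [real_inner_smul_left, real_inner_smul_left]
  gcongr

end Run

/-! ### The main theorem -/

theorem theorem2 {n lam : ℕ} (hlam : 1 ≤ lam)
    {c d : ℝ} (hc0 : 0 < c) (hc1 : c ≤ 1) (hd : 0 < d)
    -- the objective: a strictly increasing function of a non-constant affine function
    (f : EuclideanSpace ℝ (Fin n) → ℝ) (g : ℝ → ℝ) (hg : StrictMono g)
    (a : EuclideanSpace ℝ (Fin n)) (ha : a ≠ 0) (b : ℝ)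
    (hf : ∀ x, f x = g (inner ℝ a x + b))
    {Ω : Type*} [MeasurableSpace Ω] (μ : Measure Ω) [IsProbabilityMeasure μ]
    -- the mutation vectors: independent standard normal vectors
    (Z : ℕ → Fin lam → Ω → EuclideanSpace ℝ (Fin n))
    (hZ_law : ∀ t i, HasLaw (Z t i) (stdGaussian (EuclideanSpace ℝ (Fin n))) μ)
    (hZ_indep : iIndepFun (fun q : ℕ × Fin lam => Z q.1 q.2) μ)
    -- the processes of parents, step-sizes and cumulative paths of the algorithm
    (X : ℕ → Ω → EuclideanSpace ℝ (Fin n)) (σ : ℕ → Ω → ℝ)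
    (p : ℕ → Ω → EuclideanSpace ℝ (Fin n))
    (hp0 : HasLaw (p 0) (stdGaussian (EuclideanSpace ℝ (Fin n))) μ)
    (hrun : ∀ᵐ ω ∂μ, IsCSARun f c d (fun t i => Z t i ω)
      (fun t => X t ω) (fun t => σ t ω) (fun t => p t ω)) :
    -- almost sure convergence
    (∀ᵐ ω ∂μ, Tendsto (fun t : ℕ => 1 / (t : ℝ) * Real.log (σ t ω / σ 0 ω)) atTop
      (𝓝 (csaRate n lam c d))) ∧
    -- convergence in expectation
    (∀ t, Integrable (fun ω => Real.log (σ t ω / σ 0 ω)) μ) ∧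
    Tendsto (fun t : ℕ => ∫ ω, 1 / (t : ℝ) * Real.log (σ t ω / σ 0 ω) ∂μ) atTop
      (𝓝 (csaRate n lam c d)) ∧
    -- positivity of the limit and divergence of the step-size
    ((3 ≤ lam ∨ (lam = 2 ∧ c < 1)) →
      0 < csaRate n lam c d ∧ ∀ᵐ ω ∂μ, Tendsto (fun t : ℕ => σ t ω) atTop atTop) := by
  have hn : 0 < n := by
    rcases Nat.eq_zero_or_pos n with rfl | hn
    · exact absurd (Subsingleton.elim a 0) ha
    · exact hn
  have hn' : (0 : ℝ) < n := by exact_mod_cast hn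
  set u : EuclideanSpace ℝ (Fin n) := ‖a‖⁻¹ • a with hu_def
  have hu : ‖u‖ = 1 := norm_smul_inv_norm (𝕜 := ℝ) ha
  obtain ⟨ξ, hξm, hξind, hξid, hξL2, hξsq, hξmean, hξsel⟩ :=
    exists_iid_bestStep hlam hZ_law hZ_indep hu
  have hpath : ∀ᵐ ω ∂μ, ∀ t, p (t + 1) ω = (1 - c) • p t ω + √(c * (2 - c)) • ξ t ω := by
    filter_upwards [hrun, hξsel] with ω h1 h2 t
    rw [← (h2 t).2]
    exact h1.path_succ hg ha hf t (h2 t).1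
  -- the averages of the squared norms of the path
  have hα0 : 0 ≤ 1 - c := by linarith
  have hα1 : 1 - c < 1 := by linarith
  have hp0L : MemLp (p 0) 2 μ := hp0.hasGaussianLaw.memLp_two
  have hpL : ∀ s, MemLp (p s) 2 μ :=
    memLp_smoothed (fun s => (hξid s).symm.memLp_snd hξL2) hp0L hpath
  set L : ℝ := minNormalMoment lam 2 + (n - 1) + 2 * (1 - c) / c * minNormalMoment lam 1 ^ 2
    with hL
  -- The normalisation `κ ^ 2 = c * (2 - c) = 1 - (1 - c) ^ 2` cancels the prefactor.
  have hlim : √(c * (2 - c)) ^ 2 / (1 - (1 - c) ^ 2) *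
      (∫ ω, ‖ξ 0 ω‖ ^ 2 ∂μ + 2 * (1 - c) / (1 - (1 - c)) * ‖∫ ω, ξ 0 ω ∂μ‖ ^ 2) = L := by
    have h3 : 0 < c * (2 - c) := mul_pos hc0 (by linarith)
    have h4 : 1 - (1 - c) ^ 2 = c * (2 - c) := by ring
    rw [hξsq, hξmean, finrank_euclideanSpace_fin, Real.sq_sqrt h3.le, h4, div_self h3.ne', one_mul, norm_smul, hu, mul_one,
      Real.norm_eq_abs, sq_abs, sub_sub_cancel]
  have hrate : c / (2 * d) * (L / n - 1) = csaRate n lam c d := by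
    rw [hL, csaRate]
    field_simp
    ring
  have hae := ae_tendsto_average_norm_sq_smoothed hξm hξind hξid hξL2 hα0 hα1 hpath
  have hexp := tendsto_average_integral_norm_sq_smoothed hξind hξid hξL2 hα0 hα1 hp0L hpath
  rw [hlim] at hexp
  simp only [hlim] at hae
  have hform : ∀ (S : ℝ) (t : ℕ), 0 < t →
      c / (2 * d) * (S / t / n - 1) = 1 / (t : ℝ) * (c / (2 * d) * (S / n - t)) := by
    intro S t ht
    have ht' : (0 : ℝ) < t := by exact_mod_cast ht
    field_simp
  have hconv : ∀ᵐ ω ∂μ, Tendsto (fun t : ℕ => 1 / (t : ℝ) * Real.log (σ t ω / σ 0 ω)) atTop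
      (𝓝 (csaRate n lam c d)) := by
    filter_upwards [hrun, hae] with ω h1 h2
    rw [← hrate]
    refine (((h2.div_const (n : ℝ)).sub_const 1).const_mul (c / (2 * d))).congr' ?_
    filter_upwards [eventually_gt_atTop 0] with t ht
    rw [h1.log_stepSize_div t, hform _ t ht]
  have hlog : ∀ t, (fun ω => Real.log (σ t ω / σ 0 ω)) =ᵐ[μ] fun ω =>
      c / (2 * d) * ((∑ s ∈ Finset.range t, ‖p (s + 1) ω‖ ^ 2) / n - t) := fun t => by
    filter_upwards [hrun] with ω h1
    exact h1.log_stepSize_div t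
  have hsumint : ∀ t : ℕ,
      Integrable (fun ω => (∑ s ∈ Finset.range t, ‖p (s + 1) ω‖ ^ 2) / (n : ℝ)) μ := fun t =>
    (integrable_finsetSum _ fun s _ => integrable_norm_sq_of_memLp (hpL (s + 1))).div_const _
  refine ⟨hconv, fun t => ?_, ?_, fun h => ⟨csaRate_pos hn hc0 hc1 hd h, ?_⟩⟩
  · exact (((hsumint t).sub (integrable_const _)).const_mul _).congr (hlog t).symm
  · rw [← hrate]
    refine (((hexp.div_const (n : ℝ)).sub_const 1).const_mul (c / (2 * d))).congr' ?_
    filter_upwards [eventually_gt_atTop 0] with t ht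
    rw [integral_const_mul, integral_congr_ae (hlog t), integral_const_mul,
      integral_sub (hsumint t) (integrable_const _), integral_div, hform _ t ht,
      integral_finsetSum _ fun s _ => integrable_norm_sq_of_memLp (hpL (s + 1))]
    simp
  · filter_upwards [hconv, hrun] with ω h1 h2
    -- Multiplying the convergent averages by `t` sends the logarithm to infinity, because the rate
    -- is positive.
    have h3 := h1.pos_mul_atTop (csaRate_pos hn hc0 hc1 hd h) tendsto_natCast_atTop_atTop
    have h4 : Tendsto (fun t : ℕ => Real.log (σ t ω / σ 0 ω)) atTop atTop := by
      refine h3.congr' ?_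
      filter_upwards [eventually_gt_atTop 0] with t ht
      have ht' : (0 : ℝ) < t := by exact_mod_cast ht
      field_simp
    refine ((Real.tendsto_exp_atTop.comp h4).const_mul_atTop h2.stepSize_zero_pos).congr fun t => ?_
    have h5 : 0 < σ 0 ω := h2.stepSize_pos 0
    have h6 : 0 < σ t ω := h2.stepSize_pos t
    rw [Function.comp_apply, Real.exp_log (by positivity)]
    field_simp
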